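/- **Setup.** Let $n\ge 0$, let $L\subseteq\mathbb{C}^n$ be a linear subspace, and let $M$ be its matroid on $[n]=\{1,\dots,n\}$: the bases of $M$ are the sets $B$ of size $\dim L$ for which the coordinate projection $L\to\mathbb{C}^B$ is onto. Write $l_i$ for the restriction to $L$ of the $i$-th coordinate function. For each circuit $C$ of $M$ fix a nontrivial linear dependence $\sum_{i\in C}\alpha_{C,i}\,l_i=0$ (it is unique up to scaling). Let $$\widetilde I_L=\Big\langle \sum_{i\in C}\alpha_{C,i}\,x_i\prod_{j\in C\setminus i}y_j \;:\; C\text{ a circuit of }M\Big\rangle\subseteq\mathbb{C}[x_1,y_1,\dots,x_n,y_n],$$ and let $\varphi_L:\mathbb{C}[z_S: S\subseteq[n]]\to\mathbb{C}[x_i,y_i]/\widetilde I_L$ be the algebra map that sends $z_S$ to the class of $\prod_{i\in S}x_i\prod_{i\notin S}y_i$. For a circuit $C$ and $A\subseteq[n]\setminus C$ put $f_C^A=\sum_{i\in C}\alpha_{C,i}\,z_{A\cup\{i\}}$, and let $$I_L^{\mathrm{SE}}=\big\langle z_Sz_T-z_{S\cup T}z_{S\cap T},\; f_C^A \;:\;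 S,T\subseteq[n],\ C\text{ a circuit},\ A\subseteq[n]\setminus C\big\rangle .$$ Bigrade $\mathbb{C}[z_S]$ by $\deg z_S=(1,|S|)$. Let $Y_L\subseteq(\mathbb{P}^1)^n$ be the Zariski closure of the image of $L$ under $(a_1,\dots,a_n)\mapsto([a_1:1],\dots,[a_n:1])$, and embed it in $\mathbb{P}^{2^n-1}$ by the Segre map $([a_i:b_i])_i\mapsto[\prod_{i\in S}a_i\prod_{i\notin S}b_i]_{S\subseteq[n]}$. For a lattice polytope $P\subseteq\mathbb{R}^d$ let $I(P\cap\mathbb{Z}^d)\subseteq\mathbb{C}[x_1,\dots,x_d]$ be the ideal of polynomials vanishing on $P\cap\mathbb{Z}^d$, let $\operatorname{gr}I(P\cap\mathbb{Z}^d)$ be the ideal generated by the top-degree homogeneous components of its elements, and let $V_P=\{f : (f(\partial/\partial x_1,\dots,\partial/\partial x_d)\,g)(0)=0\text{ for all }g\in \operatorname{gr}I(P\cap\mathbb{Z}^d)\}$. The harmonic algebra of $P$ is $\mathcal{H}_P=\bigoplus_{m\ge0}x_0^m\,V_{mP}\subseteq\mathbb{C}[x_0,\dots,x_d]$, bigraded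 by $\deg x_0=(1,0)$ and $\deg x_i=(0,1)$ for $i\ge1$. A unimodular zonotope is $Z=A\cdot[0,1]^n\subseteq\mathbb{R}^d$, where $A$ is a $d\times n$ integer matrix of rank $d$ whose maximal minors all lie in $\{-1,0,1\}$. **Theorem.** 1. For every linear subspace $L\subseteq\mathbb{C}^n$ and every choice of the coefficients $\alpha_{C,i}$, the ideal $I_L^{\mathrm{SE}}$ is homogeneous for the bigrading, and if $n\ge1$ then $\ker\varphi_L=I_L^{\mathrm{SE}}$. Moreover, $I_L^{\mathrm{SE}}$ is the homogeneous vanishing ideal of $Y_L\subseteq\mathbb{P}^{2^n-1}$, so that the bigraded homogeneous coordinate ring of $Y_L$ under the Segre embedding is $\mathbb{C}[z_S]/I_L^{\mathrm{SE}}$. 2. If $Z=A\cdot[0,1]^n$ is a unimodular zonotope and $L\subseteq\mathbb{C}^n$ is the complexified row space of $A$, then $\mathcal{H}_Z$ is a subalgebra of $\mathbb{C}[x_0,\dots,x_d]$, and for every choice of the $\alpha_{C,i}$ there is an isomorphism of bigraded $\mathbb{C}$-algebras $\mathcal{H}_Z\cong\mathbb{C}[z_S : S\subseteq[n]]/I_L^{\mathrm{SE}}$.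 -/

import Mathlib

open MvPolynomial
open scoped LinearAlgebra.Projectivization

noncomputable section

/-! ### The matroid of a linear subspace of `ℂⁿ` and its circuits -/

/-- The restriction to `L` of the `i`-th coordinate function of `ℂⁿ`.
If `L` is the row space of a matrix `A`, a linear relation between these functionals is the same
as a linear relation between the columns of `A`. -/
def coordOn {n : ℕ} (L : Submodule ℂ (Fin n → ℂ)) (i : Fin n) : L →ₗ[ℂ] ℂ :=
  (LinearMap.proj i).comp L.subtype

theorem coordOn_apply {n : ℕ} (L : Submodule ℂ (Fin n → ℂ)) (i : Fin n) (v : L) :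
    coordOn L i v = (v : Fin n → ℂ) i := rfl

/-- The matroid on `[n]` associated to `L`: a set is independent when the coordinate functions
that it indexes are linearly independent on `L` (see `linearMatroid_isBase_iff` for its bases). -/
def linearMatroid {n : ℕ} (L : Submodule ℂ (Fin n → ℂ)) : Matroid (Fin n) :=
  (IndepMatroid.ofFinite (E := Set.univ) Set.finite_univ
    (fun I => LinearIndepOn ℂ (coordOn L) I)
    (linearIndepOn_empty ℂ _)
    (fun _ _ hJ hIJ => hJ.mono hIJ)
    (by
      intro I J hI hJ hlt
      by_contra! hcon
      have hle : Submodule.span ℂ (coordOn L '' J) ≤ Submodule.span ℂ (coordOn L '' I) := by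
        rw [Submodule.span_le]
        rintro _ ⟨e, he, rfl⟩
        by_cases heI : e ∈ I
        · exact Submodule.subset_span ⟨e, heI, rfl⟩
        · by_contra hns
          exact hcon e he heI (hI.insert hns)
      have hfin := Submodule.finrank_mono hle
      have key : ∀ K : Set (Fin n), LinearIndepOn ℂ (coordOn L) K →
          Module.finrank ℂ (Submodule.span ℂ (coordOn L '' K)) = K.ncard := by
        intro K hK
        classical
        have h1 := finrank_span_eq_card (R := ℂ) (b := fun i : K => coordOn L i) hK
        rw [← Set.image_eq_range] at h1
        rw [h1, ← Nat.card_eq_fintype_card, Nat.card_coe_set_eq]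
      rw [key I hI, key J hJ] at hfin
      omega)
    (fun _ _ => Set.subset_univ _)).matroid

theorem linearMatroid_indep_iff {n : ℕ} (L : Submodule ℂ (Fin n → ℂ)) (I : Set (Fin n)) :
    (linearMatroid L).Indep I ↔ LinearIndepOn ℂ (coordOn L) I := Iff.rfl

/-- A set `B` is independent if and only if the coordinate projection `L → ℂ^B` is onto. -/
theorem linearMatroid_indep_iff_proj {n : ℕ} (L : Submodule ℂ (Fin n → ℂ)) (B : Set (Fin n)) :
    (linearMatroid L).Indep B ↔
      L.map (LinearMap.funLeft ℂ ℂ (Subtype.val : B → Fin n)) = ⊤ := by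
  rw [linearMatroid_indep_iff]
  have h1 : LinearIndepOn ℂ (coordOn L) B ↔
      LinearIndependent ℂ (fun (i : B) (v : L) => (v : Fin n → ℂ) i) := by
    let Ψ : (L →ₗ[ℂ] ℂ) →ₗ[ℂ] (L → ℂ) := 
      { toFun := fun f => f, map_add' := fun _ _ => rfl, map_smul' := fun _ _ => rfl }
    have hΨ : LinearMap.ker Ψ = ⊥ := LinearMap.ker_eq_bot.2 DFunLike.coe_injective
    exact (LinearMap.linearIndependent_iff Ψ hΨ (v := fun i : B => coordOn L i)).symm
  rw [h1, ← span_flip_eq_top_iff_linearIndependent]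
  have h2 : Set.range (flip fun (i : B) (v : L) => (v : Fin n → ℂ) i) =
      (L.map (LinearMap.funLeft ℂ ℂ (Subtype.val : B → Fin n)) : Set (B → ℂ)) := by
    ext w
    simp only [Set.mem_range, Submodule.map_coe, Set.mem_image, Subtype.exists]
    constructor
    · rintro ⟨v, hv, rfl⟩
      exact ⟨v, hv, rfl⟩
    · rintro ⟨v, hv, rfl⟩
      exact ⟨v, hv, rfl⟩
  rw [h2, Submodule.span_eq]

/-- The bases of the matroid of `L` are the `B ⊆ [n]` of size `dim L` with `pr_B(L) = ℂ^B`. -/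
theorem linearMatroid_isBase_iff {n : ℕ} (L : Submodule ℂ (Fin n → ℂ)) (B : Set (Fin n)) :
    (linearMatroid L).IsBase B ↔ B.ncard = Module.finrank ℂ L ∧
      L.map (LinearMap.funLeft ℂ ℂ (Subtype.val : B → Fin n)) = ⊤ := by
  classical
  rw [← linearMatroid_indep_iff_proj]
  have hcard : ∀ K : Set (Fin n), LinearIndepOn ℂ (coordOn L) K →
      Module.finrank ℂ (Submodule.span ℂ (coordOn L '' K)) = K.ncard := by
    intro K hK
    have h1 := finrank_span_eq_card (R := ℂ) (b := fun i : K => coordOn L i) hK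
    rw [← Set.image_eq_range] at h1
    rw [h1, ← Nat.card_eq_fintype_card, Nat.card_coe_set_eq]
  have hdual : Module.finrank ℂ (L →ₗ[ℂ] ℂ) = Module.finrank ℂ L :=
    Subspace.dual_finrank_eq
  have htop : Submodule.span ℂ (Set.range (coordOn L)) = ⊤ := by
    have hbot : (Submodule.span ℂ (Set.range (coordOn L))).dualCoannihilator = ⊥ := by
      rw [eq_bot_iff]
      intro v hv
      rw [Submodule.mem_dualCoannihilator] at hv
      rw [Submodule.mem_bot]
      ext i
      exact hv (coordOn L i) (Submodule.subset_span ⟨i, rfl⟩)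
    have := Subspace.dualCoannihilator_dualAnnihilator_eq
      (W := Submodule.span ℂ (Set.range (coordOn L)))
    rw [← this, hbot, Submodule.dualAnnihilator_bot]
  constructor
  · intro hB
    refine ⟨?_, hB.indep⟩
    have hI := (linearMatroid_indep_iff L B).1 hB.indep
    rw [← hcard B hI, ← hdual]
    have : Submodule.span ℂ (coordOn L '' B) = ⊤ := by
      rw [eq_top_iff, ← htop, Submodule.span_le]
      rintro _ ⟨e, rfl⟩
      by_cases heB : e ∈ B
      · exact Submodule.subset_span ⟨e, heB, rfl⟩
      · by_contra hns
        have h2 : (linearMatroid L).Indep (insert e B) := hI.insert hns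
        exact heB (hB.eq_of_subset_indep h2 (Set.subset_insert e B) ▸ Set.mem_insert e B)
    rw [this, finrank_top]
  · rintro ⟨hBc, hB⟩
    rw [Matroid.isBase_iff_maximal_indep]
    refine ⟨hB, fun J hJ hBJ => ?_⟩
    have h3 : J.ncard ≤ B.ncard := by
      rw [hBc, ← hdual, ← hcard J hJ]
      exact Submodule.finrank_le _
    exact (Set.eq_of_subset_of_ncard_le hBJ h3 (Set.toFinite J)).ge

/-- `a` lists the coefficients of a nontrivial linear dependence, with index set `C`, between the
coordinate functions on `L` (the values of `a` outside `C` play no role). -/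
def IsDependence {n : ℕ} (L : Submodule ℂ (Fin n → ℂ)) (C : Finset (Fin n)) (a : Fin n → ℂ) :
    Prop :=
  (∃ i ∈ C, a i ≠ 0) ∧ ∑ i ∈ C, a i • coordOn L i = 0

/-- `α` fixes, for each circuit `C` of the matroid of `L`, a representative
`(α_{C,i})_{i ∈ C}` of the linear dependence on `C`, which is unique up to scaling. -/
def IsCircuitChoice {n : ℕ} (L : Submodule ℂ (Fin n → ℂ))
    (α : Finset (Fin n) → Fin n → ℂ) : Prop :=
  ∀ C : Finset (Fin n), (linearMatroid L).IsCircuit (C : Set (Fin n)) → IsDependence L C (α C)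

theorem exists_isCircuitChoice {n : ℕ} (L : Submodule ℂ (Fin n → ℂ)) :
    ∃ α, IsCircuitChoice L α := by
  have h : ∀ C : Finset (Fin n), ∃ a : Fin n → ℂ,
      (linearMatroid L).IsCircuit (C : Set (Fin n)) → IsDependence L C a := by
    intro C
    by_cases hC : (linearMatroid L).IsCircuit (C : Set (Fin n))
    · have h1 : ¬ LinearIndepOn ℂ (coordOn L) (C : Set (Fin n)) := hC.not_indep
      rw [linearIndepOn_finset_iff] at h1
      push Not at h1
      obtain ⟨f, hf, i, hi, hne⟩ := h1
      exact ⟨f, fun _ => ⟨⟨i, hi, hne⟩, hf⟩⟩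
    · exact ⟨0, fun h => absurd h hC⟩
  choose α hα using h
  exact ⟨α, hα⟩

/-! ### The multihomogeneous circuit ideal, the map `φ_L` and the ideal `I_L^SE` -/

/-- In `ℂ[x₁, y₁, …, xₙ, yₙ]`, the variable `x_i`. -/
abbrev varX {n : ℕ} (i : Fin n) : MvPolynomial (Fin n × Fin 2) ℂ := X (i, 0)

/-- In `ℂ[x₁, y₁, …, xₙ, yₙ]`, the variable `y_i`. -/
abbrev varY {n : ℕ} (i : Fin n) : MvPolynomial (Fin n × Fin 2) ℂ := X (i, 1)

/-- The multihomogeneous circuit equation `∑_{i ∈ C} a_i x_i ∏_{j ∈ C \ i} y_j`. -/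
def multihomCircuitEq {n : ℕ} (C : Finset (Fin n)) (a : Fin n → ℂ) :
    MvPolynomial (Fin n × Fin 2) ℂ :=
  ∑ i ∈ C, MvPolynomial.C (a i) * varX i * ∏ j ∈ C.erase i, varY j

/-- The multihomogeneous circuit ideal. -/
def multihomCircuitIdeal {n : ℕ} (L : Submodule ℂ (Fin n → ℂ))
    (α : Finset (Fin n) → Fin n → ℂ) : Ideal (MvPolynomial (Fin n × Fin 2) ℂ) :=
  Ideal.span {g | ∃ C : Finset (Fin n), (linearMatroid L).IsCircuit (C : Set (Fin n)) ∧
    g = multihomCircuitEq C (α C)}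

/-- The map `Φ : ℂ[z_S] → ℂ[x_i, y_i]`, `z_S ↦ ∏_{i ∈ S} x_i ∏_{i ∉ S} y_i`. -/
def segreHom (n : ℕ) :
    MvPolynomial (Finset (Fin n)) ℂ →ₐ[ℂ] MvPolynomial (Fin n × Fin 2) ℂ :=
  aeval fun S => (∏ i ∈ S, varX i) * ∏ i ∈ Sᶜ, varY i

/-- The map `φ_L : ℂ[z_S] → ℂ[x_i, y_i] / Ĩ_L`. -/
def phi {n : ℕ} (L : Submodule ℂ (Fin n → ℂ)) (α : Finset (Fin n) → Fin n → ℂ) :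
    MvPolynomial (Finset (Fin n)) ℂ →ₐ[ℂ]
      (MvPolynomial (Fin n × Fin 2) ℂ ⧸ multihomCircuitIdeal L α) :=
  (Ideal.Quotient.mkₐ ℂ (multihomCircuitIdeal L α)).comp (segreHom n)

/-- The linear form `f_C^A = ∑_{i ∈ C} a_i z_{A ∪ {i}}`. -/
def circuitForm {n : ℕ} (C A : Finset (Fin n)) (a : Fin n → ℂ) :
    MvPolynomial (Finset (Fin n)) ℂ :=
  ∑ i ∈ C, MvPolynomial.C (a i) * X (A ∪ {i})

/-- The ideal `I_L^SE`, generated by the binomials `z_S z_T - z_{S ∪ T} z_{S ∩ T}` and the linear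
forms `f_C^A` for `C` a circuit and `A ⊆ [n] \ C`. -/
def segreIdeal {n : ℕ} (L : Submodule ℂ (Fin n → ℂ)) (α : Finset (Fin n) → Fin n → ℂ) :
    Ideal (MvPolynomial (Finset (Fin n)) ℂ) :=
  Ideal.span
    ({g | ∃ S T : Finset (Fin n), g = X S * X T - X (S ∪ T) * X (S ∩ T)} ∪
     {g | ∃ C A : Finset (Fin n), (linearMatroid L).IsCircuit (C : Set (Fin n)) ∧ A ⊆ Cᶜ ∧
        g = circuitForm C A (α C)})

/-- The bigrading of `ℂ[z_S]`: the variable `z_S` has bidegree `(1, |S|)`. -/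
def zWeight (n : ℕ) (S : Finset (Fin n)) : ℕ × ℕ := (1, S.card)

/-- The component of bidegree `b` of `ℂ[z_S]`. -/
abbrev zPiece (n : ℕ) (b : ℕ × ℕ) : Submodule ℂ (MvPolynomial (Finset (Fin n)) ℂ) :=
  weightedHomogeneousSubmodule ℂ (zWeight n) b

/-- An ideal of `ℂ[z_S]` is homogeneous for the bigrading: it contains the bihomogeneous components
of its elements. -/
def IsBihomogeneous {n : ℕ} (I : Ideal (MvPolynomial (Finset (Fin n)) ℂ)) : Prop :=
  ∀ F ∈ I, ∀ b : ℕ × ℕ, weightedHomogeneousComponent (zWeight n) b F ∈ I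

/-! ### The arrangement Schubert variety and its Segre embedding -/

/-- The point `[a : 1]` of the projective line. -/
def affinePoint (a : ℂ) : ℙ ℂ (Fin 2 → ℂ) :=
  Projectivization.mk ℂ ![a, 1] (fun h => one_ne_zero (congrFun h 1))

/-- The embedding `ℂⁿ → (ℙ¹)ⁿ`, `(a₁, …, aₙ) ↦ ([a₁ : 1], …, [aₙ : 1])`. -/
def affineChart {n : ℕ} (v : Fin n → ℂ) : Fin n → ℙ ℂ (Fin 2 → ℂ) := fun i => affinePoint (v i)

/-- The multigrading of `ℂ[x_i, y_i]`: both `x_i` and `y_i` have degree the `i`-th unit vector. -/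
def multiWeight (n : ℕ) (ik : Fin n × Fin 2) : Fin n → ℕ := Pi.single ik.1 1

/-- The value of `F` at homogeneous coordinates of a point `p` of `(ℙ¹)ⁿ`; for multihomogeneous `F`
its vanishing does not depend on the coordinates (see `evalAt_eq_zero_iff`). -/
def evalAt {n : ℕ} (p : Fin n → ℙ ℂ (Fin 2 → ℂ)) (F : MvPolynomial (Fin n × Fin 2) ℂ) : ℂ :=
  eval (fun ik => (p ik.1).rep ik.2) F

theorem evalAt_eq_zero_iff {n : ℕ} {u : Fin n → ℕ} {F : MvPolynomial (Fin n × Fin 2) ℂ}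
    (hF : IsWeightedHomogeneous (multiWeight n) F u) (w : Fin n → Fin 2 → ℂ)
    (hw : ∀ i, w i ≠ 0) :
    evalAt (fun i => Projectivization.mk ℂ (w i) (hw i)) F = 0 ↔
      eval (fun ik : Fin n × Fin 2 => w ik.1 ik.2) F = 0 := by
  choose c hc using fun i => Projectivization.exists_smul_eq_mk_rep ℂ (w i) (hw i)
  have key : evalAt (fun i => Projectivization.mk ℂ (w i) (hw i)) F =
      (∏ i, (c i : ℂ) ^ u i) * eval (fun ik : Fin n × Fin 2 => w ik.1 ik.2) F := by
    unfold evalAt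
    rw [eval_eq', eval_eq', Finset.mul_sum]
    refine Finset.sum_congr rfl fun s hs => ?_
    have hu : ∀ i, u i = ∑ k, s (i, k) := by
      intro i
      have h1 := congrFun (hF (mem_support_iff.1 hs)) i
      rw [← h1, Finsupp.weight_apply, Finsupp.sum_fintype _ _ (by simp), Finset.sum_apply,
        Fintype.sum_prod_type, Finset.sum_eq_single i]
      · simp [multiWeight]
      · intro j _ hj
        simp [multiWeight, hj.symm]
      · simp
    simp only [← hc, Pi.smul_apply, Units.smul_def, smul_eq_mul, mul_pow, Finset.prod_mul_distrib,
      Fintype.prod_prod_type, hu, Finset.prod_pow_eq_pow_sum]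
    ring
  have hne : (∏ i, (c i : ℂ) ^ u i) ≠ 0 :=
    Finset.prod_ne_zero_iff.2 fun i _ => pow_ne_zero _ (c i).ne_zero
  rw [key, mul_eq_zero, or_iff_right hne]

/-- The Zariski closure of a subset `X` of `(ℙ¹)ⁿ`: the common zeros of all multihomogeneous
polynomials that vanish on `X`. -/
def zariskiClosure {n : ℕ} (X : Set (Fin n → ℙ ℂ (Fin 2 → ℂ))) :
    Set (Fin n → ℙ ℂ (Fin 2 → ℂ)) :=
  {p | ∀ (u : Fin n → ℕ) (F : MvPolynomial (Fin n × Fin 2) ℂ),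
    IsWeightedHomogeneous (multiWeight n) F u → (∀ q ∈ X, evalAt q F = 0) → evalAt p F = 0}

/-- The arrangement Schubert variety `Y_L ⊆ (ℙ¹)ⁿ`. -/
def arrangementSchubert {n : ℕ} (L : Submodule ℂ (Fin n → ℂ)) :
    Set (Fin n → ℙ ℂ (Fin 2 → ℂ)) :=
  zariskiClosure (affineChart '' (L : Set (Fin n → ℂ)))

/-- The Segre coordinates `c_S = ∏_{i ∈ S} a_i ∏_{i ∉ S} b_i`, where `w i = (a_i, b_i)`. -/
def segreCoord {n : ℕ} (w : Fin n → Fin 2 → ℂ) : Finset (Fin n) → ℂ :=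
  fun S => (∏ i ∈ S, w i 0) * ∏ i ∈ Sᶜ, w i 1

theorem segreCoord_ne_zero {n : ℕ} (w : Fin n → Fin 2 → ℂ) (hw : ∀ i, w i ≠ 0) :
    segreCoord w ≠ 0 := by
  classical
  intro h
  have h1 := congrFun h (Finset.univ.filter fun i => w i 0 ≠ 0)
  simp only [segreCoord, Pi.zero_apply, mul_eq_zero, Finset.prod_eq_zero_iff] at h1
  rcases h1 with ⟨i, hi, h0⟩ | ⟨i, hi, h0⟩
  · exact (Finset.mem_filter.1 hi).2 h0
  · have h2 : w i 0 = 0 := by simpa using hi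
    refine hw i (funext fun k => ?_)
    fin_cases k
    · exact h2
    · exact h0

/-- The Segre embedding `(ℙ¹)ⁿ → ℙ^{2ⁿ-1}`. -/
def segreMap {n : ℕ} (p : Fin n → ℙ ℂ (Fin 2 → ℂ)) : ℙ ℂ (Finset (Fin n) → ℂ) :=
  Projectivization.mk ℂ (segreCoord fun i => (p i).rep)
    (segreCoord_ne_zero _ fun i => (p i).rep_nonzero)

/-- The Segre embedding can be computed with any homogeneous coordinates. -/
theorem segreMap_mk {n : ℕ} (w : Fin n → Fin 2 → ℂ) (hw : ∀ i, w i ≠ 0) :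
    segreMap (fun i => Projectivization.mk ℂ (w i) (hw i)) =
      Projectivization.mk ℂ (segreCoord w) (segreCoord_ne_zero w hw) := by
  choose c hc using fun i => Projectivization.exists_smul_eq_mk_rep ℂ (w i) (hw i)
  unfold segreMap
  rw [Projectivization.mk_eq_mk_iff]
  refine ⟨∏ i, c i, ?_⟩
  funext S
  simp only [segreCoord, ← hc, Pi.smul_apply, Units.smul_def, smul_eq_mul, Finset.prod_mul_distrib,
    Units.coe_prod]
  rw [← Finset.prod_mul_prod_compl S fun i => (c i : ℂ)]
  ring

/-- The homogeneous vanishing ideal of a subset of a projective space. -/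
def projVanishingIdeal {σ : Type*} (X : Set (ℙ ℂ (σ → ℂ))) : Ideal (MvPolynomial σ ℂ) :=
  Ideal.span {F | ∃ k : ℕ, F.IsHomogeneous k ∧ ∀ p ∈ X, eval p.rep F = 0}

/-- The vanishing ideal of the image of `Y_L` under the Segre embedding; the homogeneous coordinate
ring of `Y_L ⊆ ℙ^{2ⁿ-1}` is the quotient of `ℂ[z_S]` by this ideal. -/
def segreVanishingIdeal {n : ℕ} (L : Submodule ℂ (Fin n → ℂ)) :
    Ideal (MvPolynomial (Finset (Fin n)) ℂ) :=
  projVanishingIdeal (segreMap '' arrangementSchubert L)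

/-! ### Unimodular zonotopes and harmonic algebras -/

/-- A `d × n` integer matrix of full rank `d` all of whose maximal minors lie in `{-1, 0, 1}`. -/
def IsUnimodularMatrix {d n : ℕ} (A : Matrix (Fin d) (Fin n) ℤ) : Prop :=
  (A.map (Int.cast : ℤ → ℝ)).rank = d ∧
    ∀ f : Fin d ↪ Fin n, (A.submatrix id f).det ∈ ({-1, 0, 1} : Set ℤ)

/-- The zonotope `A · [0,1]ⁿ ⊆ ℝᵈ`. -/
def zonotope {d n : ℕ} (A : Matrix (Fin d) (Fin n) ℤ) : Set (Fin d → ℝ) :=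
  (fun t => (A.map (Int.cast : ℤ → ℝ)).mulVec t) '' Set.Icc (0 : Fin n → ℝ) 1

/-- The complexified row space of `A`. -/
def rowSpace {d n : ℕ} (A : Matrix (Fin d) (Fin n) ℤ) : Submodule ℂ (Fin n → ℂ) :=
  Submodule.span ℂ (Set.range (A.map (Int.cast : ℤ → ℂ)).row)

/-- The lattice points of `P ⊆ ℝᵈ`, as a subset of `ℂᵈ`. -/
def latticeLocus {d : ℕ} (P : Set (Fin d → ℝ)) : Set (Fin d → ℂ) :=
  (fun (p : Fin d → ℤ) (i : Fin d) => (p i : ℂ)) '' {p | (fun i => (p i : ℝ)) ∈ P}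

/-- `gr I`: the ideal generated by the top degree homogeneous components of elements of `I`. -/
def grIdeal {d : ℕ} (I : Ideal (MvPolynomial (Fin d) ℂ)) : Ideal (MvPolynomial (Fin d) ℂ) :=
  Ideal.span {g | ∃ f ∈ I, g = homogeneousComponent f.totalDegree f}

/-- The differential operator `∏ᵢ (∂/∂xᵢ)^{sᵢ}`. -/
def monomialDiff {d : ℕ} (s : Fin d →₀ ℕ) : Module.End ℂ (MvPolynomial (Fin d) ℂ) :=
  ((List.finRange d).map fun i =>
    ((pderiv i).toLinearMap : Module.End ℂ (MvPolynomial (Fin d) ℂ)) ^ s i).prod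

/-- The differential operator `f(D) = f(∂/∂x₁, …, ∂/∂x_d)`, linear in `f`. -/
def polyDiff {d : ℕ} :
    MvPolynomial (Fin d) ℂ →ₗ[ℂ] Module.End ℂ (MvPolynomial (Fin d) ℂ) :=
  (basisMonomials (Fin d) ℂ).constr ℂ monomialDiff

/-- The Macaulay inverse system `I^⊥`: all `f` such that, for each `g ∈ I`, the polynomial
`f(D) · g` takes the value `0` at the origin. -/
def inverseSystem {d : ℕ} (I : Ideal (MvPolynomial (Fin d) ℂ)) :
    Submodule ℂ (MvPolynomial (Fin d) ℂ) where
  carrier := {f | ∀ g ∈ I, constantCoeff (polyDiff f g) = 0}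
  add_mem' := by
    intro f f' hf hf' g hg
    simp [hf g hg, hf' g hg]
  zero_mem' := by
    intro g _
    simp
  smul_mem' := by
    intro c f hf g hg
    have h := hf g hg
    rw [map_smul, LinearMap.smul_apply, smul_eq_C_mul, map_mul, h, mul_zero]

/-- The space `V_P = (gr I(P ∩ ℤᵈ))^⊥`. -/
def harmonicSpace {d : ℕ} (P : Set (Fin d → ℝ)) : Submodule ℂ (MvPolynomial (Fin d) ℂ) :=
  inverseSystem (grIdeal (vanishingIdeal ℂ (latticeLocus P)))

/-- The linear map `f ↦ x₀^m f` from `ℂ[x₁, …, x_d]` to `ℂ[x₀, x₁, …, x_d]`. -/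
def shiftMap (d m : ℕ) : MvPolynomial (Fin d) ℂ →ₗ[ℂ] MvPolynomial (Fin (d + 1)) ℂ :=
  (LinearMap.mulLeft ℂ (X 0 ^ m)).comp (rename Fin.succ).toLinearMap

/-- The harmonic algebra `⊕_{m ≥ 0} ℂ x₀^m ⊗ V_{mP}`, as a subspace of `ℂ[x₀, x₁, …, x_d]`. -/
def harmonicAlgebra {d : ℕ} (P : Set (Fin d → ℝ)) :
    Submodule ℂ (MvPolynomial (Fin (d + 1)) ℂ) :=
  ⨆ m : ℕ, (harmonicSpace ((fun v => (m : ℝ) • v) '' P)).map (shiftMap d m)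

/-- The bigrading of `ℂ[x₀, …, x_d]`: `x₀` has degree `(1, 0)`, the other variables `(0, 1)`. -/
def xWeight (d : ℕ) : Fin (d + 1) → ℕ × ℕ := Fin.cons (1, 0) fun _ => (0, 1)

/-- The component of bidegree `b` of the harmonic algebra. -/
def harmonicPiece {d : ℕ} (P : Set (Fin d → ℝ)) (b : ℕ × ℕ) :
    Submodule ℂ (MvPolynomial (Fin (d + 1)) ℂ) :=
  harmonicAlgebra P ⊓ weightedHomogeneousSubmodule ℂ (xWeight d) b

end

/-! The pivot is `mem_segreIdeal_iff`: `I_L^SE` is the ideal of the cone of points `(t ∏_{i ∈ S}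
v_i)_S` with `v ∈ L` and `t ∈ ℂ`. The kernel of `φ_L`, the vanishing ideal of `Y_L` and the kernel
of `z_S ↦ x₀ ∏_{j ∈ S} l_j` (for `L` the row space of `A`) are each compared with this cone.

That the generators vanish on the cone is a direct check. Conversely, let `F` be a form of degree
`k` vanishing on it. Modulo the binomials every monomial is congruent to a product over a chain of
sets, the superlevel sets of an exponent vector `p ≤ (k, …, k)`. So `F` is determined modulo the
binomials by `k` and the polynomial obtained from `z_S ↦ ∏_{i ∈ S} x_i`, which has exponents at most
`k` and vanishes on `L`. The main lemma, `mem_linearSyzygies_of_vanishing`, writes such a polynomial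
as a combination of products `x^p l`, with `l` a linear form vanishing on `L`, without exceeding the
exponent bound. Its proof is an induction on the bound that passes between `L` and `L ∩ {x_i = 0}`.
Each product `x^p l` lifts to a multiple of a shifted form `∑ a_i z_{A ∪ {i}}`, which elimination
reduces to the forms `f_C^A`.

For a unimodular zonotope `Z`, let `l_j` be the linear form given by column `j`. The harmonic space
of `mZ` is spanned by the products `∏ l_j^{p_j}` with all `p_j ≤ m` (`harmonicSpace_eq`). These
products are harmonic because pairing with `l_j` differentiates a leading form, and the derivative
of a leading form is the leading form of a finite difference along column `j`, computed from values
at lattice points of `mZ`. Equality follows from a cycle of inequalities. A harmonic polynomial is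
determined by its values on the lattice points, by positivity of the pairing, so the dimension is at
most their number. Their number is at most the dimension of the space of functions on `L` with
exponents at most `m`, by parallel deletion-restriction inductions on both sides; this is where
unimodularity enters. That dimension is at most the dimension of the span of the products. Hence the
harmonic algebra is the image of `z_S ↦ x₀ ∏_{j ∈ S} l_j`, and in particular it is closed under
multiplication. -/

/-! ### Linear forms vanishing on a subspace -/

/-- The linear form `∑ aᵢ xᵢ` vanishes on `L`. -/
def Annihilates {n : ℕ} (L : Submodule ℂ (Fin n → ℂ)) (a : Fin n → ℂ) : Prop :=
  ∀ v ∈ L, ∑ i, a i * v i = 0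

theorem sum_smul_coordOn_eq_zero_iff {n : ℕ} {L : Submodule ℂ (Fin n → ℂ)} {C : Finset (Fin n)}
    {a : Fin n → ℂ} :
    ∑ i ∈ C, a i • coordOn L i = 0 ↔ ∀ v ∈ L, ∑ i ∈ C, a i * v i = 0 := by
  constructor
  · intro h v hv
    simpa [LinearMap.sum_apply, coordOn_apply] using LinearMap.congr_fun h ⟨v, hv⟩
  · intro h
    ext ⟨v, hv⟩
    simpa [LinearMap.sum_apply, coordOn_apply] using h v hv

/-- A linear form that vanishes on a hyperplane section `L ∩ {xᵢ = 0}` extends, by a multiple of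
`xᵢ`, to one that vanishes on `L`. -/
theorem Annihilates.exists_lift {n : ℕ} {L : Submodule ℂ (Fin n → ℂ)} {i : Fin n} {a : Fin n → ℂ}
    (h : Annihilates (L ⊓ LinearMap.ker (LinearMap.proj i)) a) :
    ∃ b : ℂ, Annihilates L (a + Pi.single i b) := by
  have hs : ∀ (b : ℂ) (v : Fin n → ℂ),
      ∑ j, (a + Pi.single i b : Fin n → ℂ) j * v j = ∑ j, a j * v j + b * v i := by
    intro b v
    simp [add_mul, Finset.sum_add_distrib, Pi.single_apply]
  by_cases hu : ∃ u ∈ L, u i ≠ 0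
  · obtain ⟨u, huL, hui⟩ := hu
    -- Since `L` is the sum of the section and the line `ℂ u`, only vanishing at `u` remains to be
    -- arranged, and this fixes `b`.
    refine ⟨-(∑ j, a j * u j) / u i, fun v hv => ?_⟩
    have h1 := h (v - (v i / u i) • u)
      ⟨L.sub_mem hv (L.smul_mem _ huL), by simp [hui]⟩
    simp only [Pi.sub_apply, Pi.smul_apply, smul_eq_mul, mul_sub, Finset.sum_sub_distrib] at h1
    have h2 : ∑ j, a j * (v i / u i * u j) = v i / u i * ∑ j, a j * u j := by
      rw [Finset.mul_sum]
      exact Finset.sum_congr rfl fun j _ => by ring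
    rw [h2] at h1
    rw [hs]
    field_simp at h1 ⊢
    linear_combination h1
  · push Not at hu
    refine ⟨0, fun v hv => ?_⟩
    rw [hs, h v ⟨hv, by simpa using hu v hv⟩]
    simp

/-- Every linear form vanishing on `L` is a combination of circuit forms, also after shifting the
index sets by a set that is disjoint from the support. -/
theorem shifted_form_mem_segreIdeal {n : ℕ} {L : Submodule ℂ (Fin n → ℂ)}
    {α : Finset (Fin n) → Fin n → ℂ} (hα : IsCircuitChoice L α) (A : Finset (Fin n))
    (a : Fin n → ℂ) (ha : Annihilates L a) (hA : ∀ i ∈ A, a i = 0) :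
    ∑ i, C (a i) * X (A ∪ {i}) ∈ segreIdeal L α := by
  classical
  induction hk : (Finset.univ.filter fun i => a i ≠ 0).card using Nat.strong_induction_on
    generalizing a with
  | _ k ih =>
  by_cases h0 : ∀ i, a i = 0
  · simp [h0]
  push Not at h0
  obtain ⟨i₀, hi₀⟩ := h0
  set D := Finset.univ.filter fun i => a i ≠ 0 with hD
  have hdep : ¬ (linearMatroid L).Indep (D : Set (Fin n)) := by
    rw [linearMatroid_indep_iff, linearIndepOn_finset_iff]
    intro h
    refine hi₀ (h a ?_ i₀ (by simp [hD, hi₀]))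
    rw [sum_smul_coordOn_eq_zero_iff]
    intro v hv
    rw [← ha v hv, hD, Finset.sum_filter]
    refine Finset.sum_congr rfl fun j _ => ?_
    split_ifs with h
    · rfl
    · simp [not_not.1 h]
  obtain ⟨C', hCD, hC⟩ := (Matroid.Dep.exists_isCircuit_subset
    ⟨hdep, Set.subset_univ _⟩ : ∃ C ⊆ (D : Set (Fin n)), (linearMatroid L).IsCircuit C)
  obtain ⟨C₀, rfl⟩ : ∃ C₀ : Finset (Fin n), (C₀ : Set (Fin n)) = C' :=
    ⟨(Set.toFinite C').toFinset, by simp⟩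
  rw [Finset.coe_subset] at hCD
  obtain ⟨⟨j, hjC, hj⟩, hrel⟩ := hα C₀ hC
  rw [sum_smul_coordOn_eq_zero_iff] at hrel
  set γ : Fin n → ℂ := fun i => if i ∈ C₀ then α C₀ i else 0 with hγ
  have hsum : ∑ i, C (γ i) * X (A ∪ {i}) = circuitForm C₀ A (α C₀) := by
    rw [circuitForm, ← Finset.sum_filter_add_sum_filter_not Finset.univ (· ∈ C₀)]
    rw [Finset.sum_eq_zero (s := Finset.univ.filter fun i => i ∉ C₀) (by
      intro i hi
      simp [hγ, (Finset.mem_filter.1 hi).2])]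
    simp only [Finset.filter_univ_mem, add_zero]
    exact Finset.sum_congr rfl fun i hi => by simp [hγ, hi]
  -- The circuit lies in the support of `a`, hence is disjoint from `A`, so the shifted circuit form
  -- is one of the generators.
  have hmem : circuitForm C₀ A (α C₀) ∈ segreIdeal L α := by
    refine Ideal.subset_span (Or.inr ⟨C₀, A, hC, fun i hi => ?_, rfl⟩)
    rw [Finset.mem_compl]
    intro hiC
    exact (Finset.mem_filter.1 (hCD hiC)).2 (hA i hi)
  have haj : a j ≠ 0 := (Finset.mem_filter.1 (hCD hjC)).2
  -- This multiple of the circuit relation cancels the coefficient at `j` and creates no new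
  -- support, so the induction on the size of the support applies.
  set c : ℂ := a j / α C₀ j with hc
  have hγ0 : ∀ i, a i = 0 → γ i = 0 := by
    intro i hi
    have : i ∉ C₀ := fun h => (Finset.mem_filter.1 (hCD h)).2 hi
    simp [hγ, this]
  have hrest : ∑ i, C ((a - c • γ) i) * X (A ∪ {i}) ∈ segreIdeal L α := by
    refine ih _ ?_ (a - c • γ) ?_ ?_ rfl
    · rw [← hk]
      refine Finset.card_lt_card ⟨fun i hi => ?_, fun h => ?_⟩
      · simp only [Finset.mem_filter, Finset.mem_univ, true_and, hD] at hi ⊢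
        intro h
        exact hi (by simp [h, hγ0 i h])
      · have h1 := h (hCD hjC)
        simp [hγ, hjC, hc, hj] at h1
    · intro v hv
      have h1 : ∑ i, γ i * v i = 0 := by
        rw [← hrel v hv]
        simp [hγ, ite_mul, Finset.sum_ite_mem]
      simp only [Pi.sub_apply, Pi.smul_apply, smul_eq_mul, sub_mul, Finset.sum_sub_distrib,
        mul_assoc, ← Finset.mul_sum, h1, ha v hv, mul_zero, sub_zero]
    · intro i hi
      simp [hA i hi, hγ0 i (hA i hi)]
  have : ∑ i, C (a i) * X (A ∪ {i}) =
      ∑ i, C ((a - c • γ) i) * X (A ∪ {i}) + C c * ∑ i, C (γ i) * X (A ∪ {i}) := by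
    rw [Finset.mul_sum, ← Finset.sum_add_distrib]
    refine Finset.sum_congr rfl fun i _ => ?_
    simp only [Pi.sub_apply, Pi.smul_apply, smul_eq_mul, map_sub, map_mul]
    ring
  rw [this, hsum]
  exact Ideal.add_mem _ hrest (Ideal.mul_mem_left _ _ hmem)

/-! ### Polynomials of bounded multidegree that vanish on a subspace -/

/-- The polynomials whose exponents are bounded by `c`. -/
noncomputable abbrev boundedPoly {n : ℕ} (c : Fin n →₀ ℕ) : Submodule ℂ (MvPolynomial (Fin n) ℂ) :=
  restrictSupport ℂ (Set.Iic c)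

theorem mem_boundedPoly {n : ℕ} {c : Fin n →₀ ℕ} {F : MvPolynomial (Fin n) ℂ} :
    F ∈ boundedPoly c ↔ ∀ s, coeff s F ≠ 0 → s ≤ c := by
  rw [mem_restrictSupport_iff]
  simp [Set.subset_def]

/-- The span of the products of a monomial with a linear form vanishing on `L`, all of whose terms
have exponents bounded by `c` also after multiplication by further variables of the form. -/
noncomputable def linearSyzygies {n : ℕ} (L : Submodule ℂ (Fin n → ℂ)) (c : Fin n →₀ ℕ) :
    Submodule ℂ (MvPolynomial (Fin n) ℂ) :=
  Submodule.span ℂ {g | ∃ (p : Fin n →₀ ℕ) (a : Fin n → ℂ), Annihilates L a ∧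
    (∀ i, a i ≠ 0 → p + Finsupp.single i 1 ≤ c) ∧ g = monomial p 1 * ∑ i, C (a i) * X i}

theorem X_mul_mem_linearSyzygies {n : ℕ} {L : Submodule ℂ (Fin n → ℂ)} {c : Fin n →₀ ℕ} {i : Fin n}
    {F : MvPolynomial (Fin n) ℂ} (hF : F ∈ linearSyzygies L c) :
    X i * F ∈ linearSyzygies L (c + Finsupp.single i 1) := by
  refine Submodule.span_induction (p := fun F _ => X i * F ∈ _) ?_ ?_ ?_ ?_ hF
  · rintro _ ⟨p, a, ha, hp, rfl⟩
    refine Submodule.subset_span ⟨p + Finsupp.single i 1, a, ha, fun j hj => ?_, ?_⟩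
    · rw [add_right_comm]
      exact add_le_add_left (hp j hj) _
    · rw [← mul_assoc, X, monomial_mul, add_comm, mul_one]
  · simp
  · intro F G _ _ hF hG
    rw [mul_add]
    exact Submodule.add_mem _ hF hG
  · intro r F _ hF
    rw [mul_smul_comm]
    exact Submodule.smul_mem _ _ hF

/-- The variable `x_i` is then itself an admissible linear form, and the monomials of `F` serve as
multipliers. -/
theorem X_mul_mem_linearSyzygies_of_loop {n : ℕ} {L : Submodule ℂ (Fin n → ℂ)} {c : Fin n →₀ ℕ}
    {i : Fin n} (hi : ∀ v ∈ L, v i = 0) {F : MvPolynomial (Fin n) ℂ} (hF : F ∈ boundedPoly c) :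
    X i * F ∈ linearSyzygies L (c + Finsupp.single i 1) := by
  rw [boundedPoly, restrictSupport_eq_span] at hF
  refine Submodule.span_induction (p := fun F _ => X i * F ∈ _) ?_ ?_ ?_ ?_ hF
  · rintro _ ⟨p, hp, rfl⟩
    refine Submodule.subset_span ⟨p, Pi.single i 1, fun v hv => ?_, fun j hj => ?_, ?_⟩
    · simp [Pi.single_apply, hi v hv]
    · obtain rfl : j = i := by
        by_contra h
        simp [h] at hj
      exact add_le_add_left hp _
    · rw [Finset.sum_eq_single i (by intro j _ hj; simp [hj]) (by simp)]
      simp [mul_comm]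
  · simp
  · intro F G _ _ hF hG
    rw [mul_add]
    exact Submodule.add_mem _ hF hG
  · intro r F _ hF
    rw [mul_smul_comm]
    exact Submodule.smul_mem _ _ hF

/-- If `xᵢ` does not vanish identically on `L`, it is not a zero divisor modulo the polynomials
vanishing on `L`. -/
theorem eval_eq_zero_of_X_mul {n : ℕ} {L : Submodule ℂ (Fin n → ℂ)} {i : Fin n}
    {u : Fin n → ℂ} (hu : u ∈ L) (hui : u i ≠ 0) {F : MvPolynomial (Fin n) ℂ}
    (hF : ∀ v ∈ L, v i * eval v F = 0) (v : Fin n → ℂ) (hv : v ∈ L) : eval v F = 0 := by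
  -- Restriction to the line `v + t u`: there `x_i` becomes a polynomial in `t` with leading
  -- coefficient `u i ≠ 0`, which cancels in `ℂ[t]`.
  set q : Polynomial ℂ :=
    aeval (fun j => Polynomial.C (v j) + Polynomial.X * Polynomial.C (u j)) F with hq
  have hev : ∀ t : ℂ, q.eval t = eval (v + t • u) F := by
    intro t
    rw [hq, ← Polynomial.coe_evalRingHom, aeval_def, hom_eval₂]
    rw [eval, coe_eval₂Hom]
    congr 1
    · ext x
      simp
    · funext j
      simp [mul_comm (u j) t]
  have hmul : (Polynomial.C (v i) + Polynomial.X * Polynomial.C (u i)) * q = 0 := by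
    refine Polynomial.funext fun t => ?_
    have := hF (v + t • u) (L.add_mem hv (L.smul_mem t hu))
    rw [Polynomial.eval_mul, hev]
    simpa [mul_comm (u i) t] using this
  have hne : Polynomial.C (v i) + Polynomial.X * Polynomial.C (u i) ≠ 0 := by
    intro h
    have := congrArg (fun p => Polynomial.coeff p 1) h
    simp [Polynomial.coeff_C] at this
    exact hui this
  have h0 := (mul_eq_zero.1 hmul).resolve_left hne
  have := hev 0
  rw [h0] at this
  simpa using this.symm

theorem divMonomial_mem_boundedPoly {n : ℕ} {c : Fin n →₀ ℕ} {i : Fin n}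
    {F : MvPolynomial (Fin n) ℂ} (hF : F ∈ boundedPoly (c + Finsupp.single i 1)) :
    F.divMonomial (Finsupp.single i 1) ∈ boundedPoly c := by
  rw [mem_boundedPoly] at hF ⊢
  intro s hs
  rw [coeff_divMonomial, add_comm] at hs
  exact le_of_add_le_add_right (hF _ hs)

theorem modMonomial_mem_boundedPoly {n : ℕ} {c : Fin n →₀ ℕ} {i : Fin n}
    {F : MvPolynomial (Fin n) ℂ} (hF : F ∈ boundedPoly (c + Finsupp.single i 1)) :
    F.modMonomial (Finsupp.single i 1) ∈ boundedPoly (c.erase i) := by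
  rw [mem_boundedPoly] at hF ⊢
  intro s hs
  by_cases hle : Finsupp.single i 1 ≤ s
  · exact absurd (coeff_modMonomial_of_le F hle) hs
  rw [coeff_modMonomial_of_not_le F hle] at hs
  intro j
  by_cases hj : j = i
  · subst hj
    rw [Finsupp.single_le_iff] at hle
    omega
  · rw [Finsupp.erase_ne hj]
    simpa [Finsupp.single_apply, Ne.symm hj] using hF s hs j

/-- A form vanishing on the section becomes a form vanishing on `L` after adding some `b x_i`. The
correction `b x^p x_i` is a multiple of `x_i`. Since `p ≤ c`, the new term `x^p x_i` still respects
the bound `c + e_i`, and the cofactor of `x_i` respects `c`. -/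
theorem linearSyzygies_section_le {n : ℕ} (L : Submodule ℂ (Fin n → ℂ)) (c : Fin n →₀ ℕ)
    (i : Fin n) {F : MvPolynomial (Fin n) ℂ}
    (hF : F ∈ linearSyzygies (L ⊓ LinearMap.ker (LinearMap.proj i)) (c.erase i)) :
    ∃ G ∈ linearSyzygies L (c + Finsupp.single i 1), ∃ H ∈ boundedPoly c, F = G + X i * H := by
  have hele : c.erase i ≤ c := by
    intro j
    by_cases hj : j = i
    · simp [hj]
    · simp [Finsupp.erase_ne hj]
  refine Submodule.span_induction (p := fun F _ => ∃ G ∈ linearSyzygies L (c + Finsupp.single i 1),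
    ∃ H ∈ boundedPoly c, F = G + X i * H) ?_ ?_ ?_ ?_ hF
  · rintro _ ⟨p, a, ha, hp, rfl⟩
    by_cases h0 : ∀ j, a j = 0
    · exact ⟨0, Submodule.zero_mem _, 0, Submodule.zero_mem _, by simp [h0]⟩
    push Not at h0
    obtain ⟨k, hk⟩ := h0
    have hpc : p ≤ c := (le_add_of_nonneg_right zero_le).trans ((hp k hk).trans hele)
    have hai : a i = 0 := by
      by_contra h
      have := hp i h i
      simp at this
    obtain ⟨b, hb⟩ := ha.exists_lift
    refine ⟨_, Submodule.subset_span ⟨p, _, hb, fun j hj => ?_, rfl⟩, -(C b * monomial p 1), ?_, ?_⟩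
    · by_cases hji : j = i
      · subst hji
        exact add_le_add_left hpc _
      · refine (hp j ?_).trans (hele.trans (le_add_of_nonneg_right zero_le))
        simpa [hji] using hj
    · refine Submodule.neg_mem _ ?_
      rw [C_mul_monomial]
      exact (monomial_mem_restrictSupport ℂ).2 (Or.inl hpc)
    · have : ∑ j, C ((a + Pi.single i b : Fin n → ℂ) j) * X j =
          ∑ j, C (a j) * X j + (C b * X i : MvPolynomial (Fin n) ℂ) := by
        simp only [Pi.add_apply, map_add, add_mul, Finset.sum_add_distrib]
        congr 1
        rw [Finset.sum_eq_single i (by intro j _ hj; simp [hj]) (by simp)]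
        simp
      rw [this]
      ring
  · exact ⟨0, Submodule.zero_mem _, 0, Submodule.zero_mem _, by simp⟩
  · rintro F F' _ _ ⟨G, hG, H, hH, rfl⟩ ⟨G', hG', H', hH', rfl⟩
    exact ⟨_, Submodule.add_mem _ hG hG', _, Submodule.add_mem _ hH hH', by ring⟩
  · rintro r F _ ⟨G, hG, H, hH, rfl⟩
    exact ⟨_, Submodule.smul_mem _ r hG, _, Submodule.smul_mem _ r hH, by
      rw [smul_add, mul_smul_comm]⟩

/-- A polynomial with exponents bounded by `c` that vanishes on `L` is generated by linear forms
without leaving the bound `c`. -/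
theorem mem_linearSyzygies_of_vanishing {n : ℕ} (L : Submodule ℂ (Fin n → ℂ)) (c : Fin n →₀ ℕ)
    (F : MvPolynomial (Fin n) ℂ) (hF : F ∈ boundedPoly c) (hv : ∀ v ∈ L, eval v F = 0) :
    F ∈ linearSyzygies L c := by
  induction hk : c.degree using Nat.strong_induction_on generalizing L c F with
  | _ k ih =>
  by_cases hc : c = 0
  · subst hc
    have h1 : F = C (coeff 0 F) := by
      ext s
      rw [coeff_C]
      split_ifs with h
      · rw [h]
      · by_contra h2
        exact h (le_antisymm ((mem_boundedPoly.1 hF) s h2) zero_le).symm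
    have h2 := hv 0 L.zero_mem
    rw [h1, eval_C] at h2
    rw [h1, h2, map_zero]
    exact Submodule.zero_mem _
  obtain ⟨i, hi⟩ : ∃ i, c i ≠ 0 := by
    by_contra! h
    exact hc (Finsupp.ext h)
  obtain ⟨c, rfl⟩ : ∃ c', c = c' + Finsupp.single i 1 :=
    ⟨c - Finsupp.single i 1, (tsub_add_cancel_of_le (by
      rw [Finsupp.single_le_iff]; omega)).symm⟩
  have hdeg : (c + Finsupp.single i 1).degree = c.degree + 1 := by simp
  have herase : (c.erase i).degree ≤ c.degree := by
    rw [Finsupp.degree_eq_sum, Finsupp.degree_eq_sum]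
    refine Finset.sum_le_sum fun j _ => ?_
    by_cases hj : j = i
    · simp [hj]
    · simp [Finsupp.erase_ne hj]
  -- The part of `F` free of `x_i` vanishes on `L ∩ {x_i = 0}`, where induction applies. Lifting the
  -- result back to `L` leaves `F = x_i Q + G` with `G` already of the required form and `Q` bounded
  -- by `c`.
  have hdec := divMonomial_add_modMonomial F (Finsupp.single i 1)
  obtain ⟨G, hG, H, hH, hGH⟩ := linearSyzygies_section_le L c i
    (ih _ (by omega) (L ⊓ LinearMap.ker (LinearMap.proj i)) (c.erase i)
      (F.modMonomial (Finsupp.single i 1)) (modMonomial_mem_boundedPoly hF) (by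
        rintro v ⟨hvL, hvi⟩
        have hvi : v i = 0 := hvi
        have := hv v hvL
        rw [← hdec, map_add, map_mul, ← X] at this
        simpa [hvi] using this) rfl)
  have hGv : ∀ v ∈ L, eval v G = 0 := by
    intro v hvL
    refine Submodule.span_induction (p := fun G _ => eval v G = 0) ?_ ?_ ?_ ?_ hG
    · rintro _ ⟨p, a, ha, -, rfl⟩
      simp [ha v hvL]
    · simp
    · intro _ _ _ _ h h'
      simp [h, h']
    · intro _ _ _ h
      simp [h]
  set Q := F.divMonomial (Finsupp.single i 1) + H with hQ
  have hQB : Q ∈ boundedPoly c := Submodule.add_mem _ (divMonomial_mem_boundedPoly hF) hH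
  have hFQ : F = X i * Q + G := by
    rw [← hdec, hGH, hQ, X]
    ring
  rw [hFQ]
  refine Submodule.add_mem _ ?_ hG
  -- Since `x_i Q` vanishes on `L`, either `x_i` can be cancelled and induction applies to `Q`, or
  -- `x_i` vanishes on `L`.
  by_cases hu : ∃ u ∈ L, u i ≠ 0
  · obtain ⟨u, huL, hui⟩ := hu
    refine X_mul_mem_linearSyzygies (ih _ (by omega) L c Q hQB ?_ rfl)
    refine eval_eq_zero_of_X_mul huL hui fun v hvL => ?_
    have := hv v hvL
    rw [hFQ, map_add, hGv v hvL] at this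
    simpa using this
  · push Not at hu
    exact X_mul_mem_linearSyzygies_of_loop hu hQB

/-! ### Standard monomials in the variables `z_S` -/

/-- The exponent vector of the squarefree monomial `∏_{i ∈ S} xᵢ`. -/
noncomputable def setExp {n : ℕ} (S : Finset (Fin n)) : Fin n →₀ ℕ :=
  ∑ i ∈ S, Finsupp.single i 1

theorem setExp_apply {n : ℕ} (S : Finset (Fin n)) (i : Fin n) :
    setExp S i = if i ∈ S then 1 else 0 := by
  simp [setExp, Finsupp.finsetSum_apply, Finsupp.single_apply]

theorem monomial_setExp {n : ℕ} (S : Finset (Fin n)) :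
    monomial (setExp S) (1 : ℂ) = ∏ i ∈ S, X i := by
  rw [setExp, monomial_sum_one]
  rfl

/-- The constant exponent vector `(k, …, k)`. -/
noncomputable def constExp (n k : ℕ) : Fin n →₀ ℕ := Finsupp.equivFunOnFinite.symm fun _ => k

@[simp]
theorem constExp_apply {n k : ℕ} (i : Fin n) : constExp n k i = k := rfl

/-- The standard monomial of degree `k` with exponent vector `p`, the product of the variables
indexed by the superlevel sets of `p`. -/
noncomputable def chainMonomial {n : ℕ} (k : ℕ) (p : Fin n →₀ ℕ) :
    MvPolynomial (Finset (Fin n)) ℂ :=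
  ∏ j ∈ Finset.range k, X (Finset.univ.filter fun i => j < p i)

/-- The algebra map `z_S ↦ ∏_{i ∈ S} xᵢ`. -/
noncomputable def dehomogenize (n : ℕ) :
    MvPolynomial (Finset (Fin n)) ℂ →ₐ[ℂ] MvPolynomial (Fin n) ℂ :=
  aeval fun S => monomial (setExp S) 1

theorem dehomogenize_monomial {n : ℕ} (s : Finset (Fin n) →₀ ℕ) (r : ℂ) :
    dehomogenize n (monomial s r) = monomial (Finsupp.weight setExp s) r := by
  rw [dehomogenize, aeval_monomial, Finsupp.weight_apply, Finsupp.prod]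
  simp only [monomial_pow, one_pow]
  rw [← monomial_sum_one, algebraMap_eq, C_mul_monomial, mul_one, Finsupp.sum]

theorem weight_setExp_le {n : ℕ} (s : Finset (Fin n) →₀ ℕ) :
    Finsupp.weight setExp s ≤ constExp n s.degree := by
  intro i
  rw [Finsupp.weight_apply, Finsupp.sum, Finsupp.finsetSum_apply, constExp_apply, Finsupp.degree]
  refine Finset.sum_le_sum fun S _ => ?_
  rw [Finsupp.smul_apply, setExp_apply]
  split_ifs <;> simp

theorem eval_dehomogenize {n : ℕ} (v : Fin n → ℂ) (F : MvPolynomial (Finset (Fin n)) ℂ) :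
    eval v (dehomogenize n F) = eval (fun S => ∏ i ∈ S, v i) F := by
  rw [dehomogenize, aeval_def, ← coe_eval₂Hom, ← RingHom.comp_apply]
  congr 1
  refine ringHom_ext (fun r => by simp) fun S => ?_
  simp [monomial_setExp]

theorem degree_of_mem_support {τ : Type*} {k : ℕ} {F : MvPolynomial τ ℂ} (hF : F.IsHomogeneous k)
    {s : τ →₀ ℕ} (hs : s ∈ F.support) : s.degree = k := by
  have := hF (mem_support_iff.1 hs)
  rwa [show (1 : τ → ℕ) = fun _ => 1 from rfl, ← Finsupp.degree_eq_weight_one] at this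

theorem dehomogenize_mem_boundedPoly {n k : ℕ} {F : MvPolynomial (Finset (Fin n)) ℂ}
    (hF : F.IsHomogeneous k) : dehomogenize n F ∈ boundedPoly (constExp n k) := by
  rw [F.as_sum, map_sum]
  refine Submodule.sum_mem _ fun s hs => ?_
  rw [dehomogenize_monomial]
  refine (monomial_mem_restrictSupport ℂ).2 (Or.inl ?_)
  rw [← degree_of_mem_support hF hs]
  exact weight_setExp_le s

/-- The index `i` lies in as many of the sets as there are `j < k` with `j < p i`; the bound `p i ≤
k` makes this number `p i`. -/
theorem dehomogenize_chainMonomial {n k : ℕ} {p : Fin n →₀ ℕ} (hp : p ≤ constExp n k) :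
    dehomogenize n (chainMonomial k p) = monomial p 1 := by
  rw [chainMonomial, map_prod]
  simp only [dehomogenize, aeval_X]
  rw [← monomial_sum_one]
  congr 2
  ext i
  simp only [Finsupp.finsetSum_apply, setExp_apply, Finset.mem_filter, Finset.mem_univ, true_and]
  rw [Finset.sum_boole]
  have : (Finset.range k).filter (fun j => j < p i) = Finset.range (p i) := by
    ext j
    have := hp i
    rw [constExp_apply] at this
    simp only [Finset.mem_filter, Finset.mem_range]
    omega
  rw [this]
  simp

theorem chainMonomial_isHomogeneous {n k : ℕ} (p : Fin n →₀ ℕ) :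
    (chainMonomial k p).IsHomogeneous k := by
  have := IsHomogeneous.prod (Finset.range k)
    (fun j => (X (Finset.univ.filter fun i => j < p i) : MvPolynomial (Finset (Fin n)) ℂ))
    (fun _ => 1) (fun j _ => isHomogeneous_X _ _)
  simpa [chainMonomial] using this

section Straightening

variable {n : ℕ} (L : Submodule ℂ (Fin n → ℂ)) (α : Finset (Fin n) → Fin n → ℂ)

theorem mk_X_mul_X (S T : Finset (Fin n)) :
    Ideal.Quotient.mk (segreIdeal L α) (X S * X T) =
      Ideal.Quotient.mk (segreIdeal L α) (X (S ∪ T) * X (S ∩ T)) :=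
  Ideal.Quotient.eq.2 (Ideal.subset_span (Or.inl ⟨S, T, rfl⟩))

/-- The set `S` is pushed through the chain. At level `k` a binomial replaces the carried set `S ∩
{p ≥ k}` and the chain member `{p > k}` by their union and intersection. The union is the level `k`
set of `p + 1_S`, and the intersection `S ∩ {p ≥ k + 1}` is carried on. -/
theorem mk_X_mul_chainMonomial_aux (S : Finset (Fin n)) (p : Fin n →₀ ℕ) (k : ℕ) :
    Ideal.Quotient.mk (segreIdeal L α) (X S * chainMonomial k p) =
      Ideal.Quotient.mk (segreIdeal L α)
        (chainMonomial k (p + setExp S) * X (S.filter fun i => k ≤ p i)) := by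
  induction k with
  | zero => simp [chainMonomial]
  | succ k ih =>
    have hsucc : ∀ q : Fin n →₀ ℕ, chainMonomial (k + 1) q =
        chainMonomial k q * X (Finset.univ.filter fun i => k < q i) := fun q => by
      rw [chainMonomial, Finset.prod_range_succ, chainMonomial]
    have h1 : (S.filter fun i => k ≤ p i) ∪ (Finset.univ.filter fun i => k < p i) =
        Finset.univ.filter fun i => k < (p + setExp S) i := by
      ext i
      simp only [Finset.mem_union, Finset.mem_filter, Finset.mem_univ, true_and,
        Finsupp.add_apply, setExp_apply]
      split_ifs with h
      · simp [h]; omega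
      · simp [h]
    have h2 : (S.filter fun i => k ≤ p i) ∩ (Finset.univ.filter fun i => k < p i) =
        S.filter fun i => k + 1 ≤ p i := by
      ext i
      simp only [Finset.mem_inter, Finset.mem_filter, Finset.mem_univ, true_and]
      constructor
      · rintro ⟨⟨h, -⟩, h'⟩
        exact ⟨h, h'⟩
      · rintro ⟨h, h'⟩
        exact ⟨⟨h, by omega⟩, h'⟩
    rw [hsucc, hsucc, ← mul_assoc, map_mul, ih, ← map_mul, mul_assoc, map_mul, mk_X_mul_X, h1, h2,
      ← map_mul, mul_assoc]

/-- Multiplication of a standard monomial by a variable, modulo the Segre binomials. -/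
theorem mk_X_mul_chainMonomial (S : Finset (Fin n)) {p : Fin n →₀ ℕ} {k : ℕ}
    (hp : p ≤ constExp n k) :
    Ideal.Quotient.mk (segreIdeal L α) (X S * chainMonomial k p) =
      Ideal.Quotient.mk (segreIdeal L α) (chainMonomial (k + 1) (p + setExp S)) := by
  -- When `p ≤ k`, the set left over, `S ∩ {p ≥ k}`, is exactly the level `k` set of `p + 1_S`, so
  -- it completes the chain.
  rw [mk_X_mul_chainMonomial_aux, chainMonomial, chainMonomial, Finset.prod_range_succ]
  congr 3
  ext i
  have := hp i
  simp only [constExp_apply] at this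
  simp only [Finset.mem_filter, Finset.mem_univ, true_and, Finsupp.add_apply, setExp_apply]
  split_ifs with h
  · simp [h]
  · simp [h]; exact this

theorem mk_monomial_eq_chainMonomial (s : Finset (Fin n) →₀ ℕ) :
    Ideal.Quotient.mk (segreIdeal L α) (monomial s 1) =
      Ideal.Quotient.mk (segreIdeal L α) (chainMonomial s.degree (Finsupp.weight setExp s)) := by
  induction hk : s.degree generalizing s with
  | zero =>
    rw [Finsupp.degree_eq_zero_iff] at hk
    subst hk
    simp [chainMonomial]
  | succ k ih =>
    obtain ⟨S, hS⟩ : ∃ S, s S ≠ 0 := by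
      by_contra! h
      have : s = 0 := Finsupp.ext h
      simp [this] at hk
    obtain ⟨t, rfl⟩ : ∃ t, s = t + Finsupp.single S 1 :=
      ⟨s - Finsupp.single S 1, (tsub_add_cancel_of_le (by
        rw [Finsupp.single_le_iff]; omega)).symm⟩
    have ht : t.degree = k := by simpa using hk
    have h1 : (monomial (t + Finsupp.single S 1) (1 : ℂ)) = X S * monomial t 1 := by
      rw [X, monomial_mul, add_comm, mul_one]
    rw [h1, map_mul, ih t ht, ← map_mul, mk_X_mul_chainMonomial L α S (ht ▸ weight_setExp_le t)]
    congr 2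
    rw [map_add, Finsupp.weight_single, one_smul]

/-- The linear map that sends `x^p` to the standard monomial of degree `k` and exponent `p`. -/
noncomputable def chainMap (n k : ℕ) :
    MvPolynomial (Fin n) ℂ →ₗ[ℂ] MvPolynomial (Finset (Fin n)) ℂ :=
  (basisMonomials (Fin n) ℂ).constr ℂ (chainMonomial k)

theorem chainMap_monomial (k : ℕ) (p : Fin n →₀ ℕ) :
    chainMap n k (monomial p 1) = chainMonomial k p := by
  have := (basisMonomials (Fin n) ℂ).constr_basis ℂ (chainMonomial k) p
  rwa [coe_basisMonomials] at this

/-- Both sides agree on monomials, since straightening keeps the degree and the total exponent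
vector. -/
theorem mk_eq_mk_chainMap {k : ℕ} {F : MvPolynomial (Finset (Fin n)) ℂ} (hF : F.IsHomogeneous k) :
    Ideal.Quotient.mk (segreIdeal L α) F =
      Ideal.Quotient.mk (segreIdeal L α) (chainMap n k (dehomogenize n F)) := by
  conv_lhs => rw [F.as_sum]
  conv_rhs => rw [F.as_sum]
  simp only [map_sum]
  refine Finset.sum_congr rfl fun s hs => ?_
  have hk := degree_of_mem_support hF hs
  have h1 : ∀ {τ : Type} (t : τ →₀ ℕ), monomial t (coeff s F) = coeff s F • monomial t (1 : ℂ) := by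
    intro τ t
    rw [smul_monomial, smul_eq_mul, mul_one]
  rw [dehomogenize_monomial, h1 (Finsupp.weight setExp s), h1 s, LinearMap.map_smul,
    chainMap_monomial, smul_eq_C_mul, smul_eq_C_mul, map_mul, map_mul, mk_monomial_eq_chainMonomial, hk]

variable {L α}

theorem chainMap_mem_segreIdeal (hα : IsCircuitChoice L α) {k : ℕ} {F : MvPolynomial (Fin n) ℂ}
    (hF : F ∈ linearSyzygies L (constExp n k)) : chainMap n k F ∈ segreIdeal L α := by
  refine Submodule.span_induction (p := fun F _ => chainMap n k F ∈ segreIdeal L α)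
    ?_ ?_ ?_ ?_ hF
  · rintro _ ⟨p, a, ha, hp, rfl⟩
    by_cases h0 : ∀ i, a i = 0
    · simp [h0]
    push Not at h0
    obtain ⟨j, hj⟩ := h0
    obtain ⟨k, rfl⟩ : ∃ k', k = k' + 1 := by
      refine ⟨k - 1, ?_⟩
      have := hp j hj j
      simp at this
      omega
    have hpk : ∀ i, p i ≤ k + 1 := by
      intro i
      have := hp j hj i
      simp only [Finsupp.add_apply, constExp_apply] at this
      omega
    -- The saturated coordinates form `A`, which is disjoint from the support of `a` because the
    -- exponents of `x^p x_i` stay within the bound there. With `q = min(p, k)` one has `p + e_i = q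
    -- + 1_{A ∪ {i}}`, so all terms share the factor `chainMonomial k q`.
    set A := Finset.univ.filter fun i => p i = k + 1 with hA
    set q := p ⊓ constExp n k with hq
    have hmon : monomial p 1 * ∑ i, C (a i) * X i =
        ∑ i, a i • monomial (p + Finsupp.single i 1) (1 : ℂ) := by
      rw [Finset.mul_sum]
      refine Finset.sum_congr rfl fun i _ => ?_
      rw [X, C_mul_monomial, monomial_mul, smul_monomial, one_mul, mul_one, smul_eq_mul, mul_one]
    have hterm : ∀ i, Ideal.Quotient.mk (segreIdeal L α)
        (a i • chainMonomial (k + 1) (p + Finsupp.single i 1)) =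
        Ideal.Quotient.mk (segreIdeal L α) ((C (a i) * X (A ∪ {i})) * chainMonomial k q) := by
      intro i
      by_cases hi : a i = 0
      · simp [hi]
      have hpi : p i ≤ k := by
        have := hp i hi i
        simp at this
        omega
      have hpq : p + Finsupp.single i 1 = q + setExp (A ∪ {i}) := by
        ext l
        have := hpk l
        simp only [hq, Finsupp.add_apply, Finsupp.inf_apply, constExp_apply, setExp_apply, hA,
          Finset.mem_union, Finset.mem_filter, Finset.mem_univ, true_and, Finset.mem_singleton,
          Finsupp.single_apply]
        by_cases hl : i = l
        · subst hl
          simp [hpi]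
        · have hl' : ¬ l = i := fun h => hl h.symm
          simp only [hl, hl', or_false, if_false]
          split_ifs <;> omega
      rw [hpq, smul_eq_C_mul, map_mul, ← mk_X_mul_chainMonomial L α _ (inf_le_right), ← map_mul,
        mul_assoc]
    rw [hmon, map_sum, ← Ideal.Quotient.eq_zero_iff_mem, map_sum]
    simp only [map_smul, chainMap_monomial]
    rw [Finset.sum_congr rfl fun i _ => hterm i, ← map_sum, ← Finset.sum_mul,
      Ideal.Quotient.eq_zero_iff_mem]
    refine Ideal.mul_mem_right _ _ (shifted_form_mem_segreIdeal hα A a ha fun i hi => ?_)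
    by_contra h
    have h1 := hp i h i
    have h2 := (Finset.mem_filter.1 hi).2
    simp at h1
    omega
  · simp
  · intro F G _ _ hF hG
    rw [map_add]
    exact Ideal.add_mem _ hF hG
  · intro r F _ hF
    rw [map_smul, smul_eq_C_mul]
    exact Ideal.mul_mem_left _ _ hF

theorem mem_segreIdeal_of_isHomogeneous (hα : IsCircuitChoice L α) {k : ℕ}
    {F : MvPolynomial (Finset (Fin n)) ℂ} (hF : F.IsHomogeneous k)
    (hv : ∀ v ∈ L, eval (fun S => ∏ i ∈ S, v i) F = 0) : F ∈ segreIdeal L α := by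
  rw [← Ideal.Quotient.eq_zero_iff_mem, mk_eq_mk_chainMap L α hF, Ideal.Quotient.eq_zero_iff_mem]
  refine chainMap_mem_segreIdeal hα (mem_linearSyzygies_of_vanishing L _ _
    (dehomogenize_mem_boundedPoly hF) fun v hvL => ?_)
  rw [eval_dehomogenize]
  exact hv v hvL

theorem eval_smul_of_isHomogeneous {τ : Type*} {k : ℕ} {F : MvPolynomial τ ℂ}
    (hF : F.IsHomogeneous k) (t : ℂ) (x : τ → ℂ) :
    eval (fun S => t * x S) F = t ^ k * eval x F := by
  rw [eval_eq, eval_eq, Finset.mul_sum]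
  refine Finset.sum_congr rfl fun s hs => ?_
  have hk := degree_of_mem_support hF hs
  simp only [mul_pow, Finset.prod_mul_distrib]
  rw [Finset.prod_pow_eq_pow_sum, ← hk, Finsupp.degree_apply]
  ring

/-- The ideal `I_L^SE` consists of the polynomials that vanish on the cone over the image of `L`. -/
theorem mem_segreIdeal_iff (hα : IsCircuitChoice L α) {F : MvPolynomial (Finset (Fin n)) ℂ} :
    F ∈ segreIdeal L α ↔ ∀ v ∈ L, ∀ t : ℂ, eval (fun S => t * ∏ i ∈ S, v i) F = 0 := by
  constructor
  · intro hF v hv t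
    suffices h : segreIdeal L α ≤ RingHom.ker (eval fun S => t * ∏ i ∈ S, v i) from h hF
    rw [segreIdeal, Ideal.span_le]
    rintro _ (⟨S, T, rfl⟩ | ⟨C₀, A, hC, hA, rfl⟩)
    · have := Finset.prod_union_inter (s₁ := S) (s₂ := T) (f := v)
      simp only [SetLike.mem_coe, RingHom.mem_ker, map_sub, map_mul, eval_X]
      linear_combination (-t ^ 2) * this
    · have h1 := sum_smul_coordOn_eq_zero_iff.1 (hα C₀ hC).2 v hv
      simp only [SetLike.mem_coe, RingHom.mem_ker, circuitForm, map_sum, map_mul, eval_X, eval_C]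
      rw [← mul_zero (t * ∏ i ∈ A, v i), ← h1, Finset.mul_sum]
      refine Finset.sum_congr rfl fun i hi => ?_
      have hiA : i ∉ A := fun h => Finset.mem_compl.1 (hA h) hi
      rw [Finset.union_comm, ← Finset.insert_eq, Finset.prod_insert hiA]
      ring
  · intro h
    rw [← sum_homogeneousComponent F]
    refine Ideal.sum_mem _ fun k _ => ?_
    refine mem_segreIdeal_of_isHomogeneous hα (homogeneousComponent_isHomogeneous k F)
      fun v hv => ?_
    -- On the cone, `F` becomes a polynomial in `t` whose coefficients are the values of the
    -- homogeneous components. It vanishes for all `t`, hence so does each coefficient.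
    set q : Polynomial ℂ := ∑ k ∈ Finset.range (F.totalDegree + 1),
      Polynomial.monomial k (eval (fun S => ∏ i ∈ S, v i) (homogeneousComponent k F)) with hq
    have hq0 : q = 0 := by
      refine Polynomial.funext fun t => ?_
      rw [Polynomial.eval_zero, ← h v hv t]
      conv_rhs => rw [← sum_homogeneousComponent F]
      rw [hq, Polynomial.eval_finsetSum, map_sum]
      refine Finset.sum_congr rfl fun k _ => ?_
      rw [eval_smul_of_isHomogeneous (homogeneousComponent_isHomogeneous k F),
        Polynomial.eval_monomial, mul_comm]
    by_cases hk : k < F.totalDegree + 1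
    · have := congrArg (fun p => Polynomial.coeff p k) hq0
      simp only [hq, Polynomial.finsetSum_coeff, Polynomial.coeff_monomial, Polynomial.coeff_zero]
        at this
      rw [Finset.sum_ite_eq' (Finset.range (F.totalDegree + 1)) k,
        if_pos (Finset.mem_range.2 hk)] at this
      exact this
    · rw [homogeneousComponent_eq_zero k F (by omega), map_zero]

end Straightening

/-! ### The ideal `I_L^SE` and the arrangement Schubert variety -/

section SchubertVariety

variable {n : ℕ} {L : Submodule ℂ (Fin n → ℂ)} {α : Finset (Fin n) → Fin n → ℂ}

theorem circuitForm_isWeightedHomogeneous {C₀ A : Finset (Fin n)} (hA : A ⊆ C₀ᶜ) (a : Fin n → ℂ) :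
    IsWeightedHomogeneous (zWeight n) (circuitForm C₀ A a) (1, A.card + 1) := by
  refine IsWeightedHomogeneous.sum _ _ _ fun i hi => ?_
  have hiA : i ∉ A := fun h => Finset.mem_compl.1 (hA h) hi
  have h1 := (isWeightedHomogeneous_C (zWeight n) (a i)).mul
    (isWeightedHomogeneous_X ℂ (zWeight n) (A ∪ {i}))
  have h2 : (A ∪ {i}).card = A.card + 1 := by
    rw [Finset.union_comm, ← Finset.insert_eq, Finset.card_insert_of_notMem hiA]
  rwa [zero_add, zWeight, h2] at h1

/-- The generators are bihomogeneous: `|S| + |T| = |S ∪ T| + |S ∩ T|`, and all sets `A ∪ {i}` with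
`i ∈ C` have size `|A| + 1`. -/
theorem segreIdeal_isBihomogeneous : IsBihomogeneous (segreIdeal L α) := by
  let _ := weightedGradedAlgebra ℂ (zWeight n)
  have h : (segreIdeal L α).IsHomogeneous (weightedHomogeneousSubmodule ℂ (zWeight n)) := by
    refine Ideal.homogeneous_span _ _ ?_
    rintro _ (⟨S, T, rfl⟩ | ⟨C₀, A, hC, hA, rfl⟩)
    · refine ⟨zWeight n S + zWeight n T, ?_⟩
      refine Submodule.sub_mem _ ((isWeightedHomogeneous_X ℂ (zWeight n) S).mul
        (isWeightedHomogeneous_X ℂ (zWeight n) T)) ?_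
      have h1 : zWeight n S + zWeight n T = zWeight n (S ∪ T) + zWeight n (S ∩ T) := by
        simp [zWeight, Finset.card_union_add_card_inter]
      rw [h1]
      exact (isWeightedHomogeneous_X ℂ (zWeight n) _).mul (isWeightedHomogeneous_X ℂ (zWeight n) _)
    · exact ⟨_, circuitForm_isWeightedHomogeneous hA _⟩
  intro F hF b
  exact weightedHomogeneousComponent_mem_of_mem ℂ (zWeight n) h hF b

theorem eval_segreHom (x : Fin n × Fin 2 → ℂ) (F : MvPolynomial (Finset (Fin n)) ℂ) :
    eval x (segreHom n F) =
      eval (fun S => (∏ i ∈ S, x (i, 0)) * ∏ i ∈ Sᶜ, x (i, 1)) F := by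
  rw [segreHom, aeval_def, ← coe_eval₂Hom, ← RingHom.comp_apply]
  congr 1
  refine ringHom_ext (fun r => by simp) fun S => ?_
  simp [varX, varY]

theorem segreHom_circuitForm {C₀ A : Finset (Fin n)} (hA : A ⊆ C₀ᶜ) (a : Fin n → ℂ) :
    segreHom n (circuitForm C₀ A a) =
      multihomCircuitEq C₀ a * ((∏ i ∈ A, varX i) * ∏ i ∈ (C₀ ∪ A)ᶜ, varY i) := by
  rw [circuitForm, multihomCircuitEq, map_sum, Finset.sum_mul]
  refine Finset.sum_congr rfl fun i hi => ?_
  have hiA : i ∉ A := fun h => Finset.mem_compl.1 (hA h) hi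
  have hset : (A ∪ {i})ᶜ = C₀.erase i ∪ (C₀ ∪ A)ᶜ := by
    ext j
    simp only [Finset.mem_compl, Finset.mem_union, Finset.mem_singleton, Finset.mem_erase]
    have h1 : j ∈ A → j ∉ C₀ := fun h => Finset.mem_compl.1 (hA h)
    by_cases hj : j = i
    · subst hj
      simp [hi]
    · tauto
  have hdis : Disjoint (C₀.erase i) (C₀ ∪ A)ᶜ := by
    rw [Finset.disjoint_left]
    intro j hj
    simp [Finset.mem_of_mem_erase hj]
  rw [map_mul, segreHom, aeval_X, aeval_C, hset, Finset.prod_union hdis, Finset.union_comm,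
    ← Finset.insert_eq, Finset.prod_insert hiA, algebraMap_eq]
  ring

theorem segreHom_X_mul_X (S T : Finset (Fin n)) :
    segreHom n (X S * X T) = segreHom n (X (S ∪ T) * X (S ∩ T)) := by
  simp only [segreHom, map_mul, aeval_X]
  have h1 := Finset.prod_union_inter (s₁ := S) (s₂ := T)
    (f := fun i => (varX i : MvPolynomial (Fin n × Fin 2) ℂ))
  have h2 := Finset.prod_union_inter (s₁ := Sᶜ) (s₂ := Tᶜ)
    (f := fun i => (varY i : MvPolynomial (Fin n × Fin 2) ℂ))
  rw [← Finset.compl_inter, ← Finset.compl_union] at h2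
  linear_combination -((∏ i ∈ Sᶜ, varY i) * ∏ i ∈ Tᶜ, varY i) * h1 -
    (∏ i ∈ S ∪ T, varX i) * (∏ i ∈ S ∩ T, varX i) * h2

theorem ker_phi_eq (hα : IsCircuitChoice L α) (hn : 1 ≤ n) :
    RingHom.ker (phi L α) = segreIdeal L α := by
  have hker : ∀ F, F ∈ RingHom.ker (phi L α) ↔ segreHom n F ∈ multihomCircuitIdeal L α := by
    intro F
    rw [RingHom.mem_ker, ← Ideal.Quotient.eq_zero_iff_mem]
    rfl
  refine le_antisymm (fun F hF => ?_) ?_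
  · rw [hker] at hF
    rw [mem_segreIdeal_iff hα]
    intro v hv t
    -- Rescaling the homogeneous coordinates in one factor by `t` multiplies every Segre coordinate
    -- by `t`. This needs `n ≥ 1`: for `n = 0` the kernel contains `z_∅ - 1`.
    set s : Fin n → ℂ := fun i => if i = ⟨0, hn⟩ then t else 1 with hs
    set x : Fin n × Fin 2 → ℂ := fun ik => s ik.1 * ![v ik.1, 1] ik.2 with hx
    have h0 : eval x (segreHom n F) = 0 := by
      suffices h : multihomCircuitIdeal L α ≤ RingHom.ker (eval x) from h hF
      rw [multihomCircuitIdeal, Ideal.span_le]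
      rintro _ ⟨C₀, hC, rfl⟩
      have h1 := sum_smul_coordOn_eq_zero_iff.1 (hα C₀ hC).2 v hv
      simp only [SetLike.mem_coe, RingHom.mem_ker, multihomCircuitEq, map_sum, map_mul, map_prod,
        eval_X, eval_C]
      rw [← mul_zero (∏ i ∈ C₀, s i), ← h1, Finset.mul_sum]
      refine Finset.sum_congr rfl fun i hi => ?_
      rw [← Finset.mul_prod_erase C₀ _ hi]
      simp [hx]
      ring
    rw [eval_segreHom] at h0
    rw [← h0]
    congr 2
    funext S
    simp only [hx, Finset.prod_mul_distrib, Matrix.cons_val_zero, Matrix.cons_val_one,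
      mul_one]
    have h2 : (∏ i ∈ S, s i) * ∏ i ∈ Sᶜ, s i = t := by
      rw [Finset.prod_mul_prod_compl]
      simp [hs]
    rw [← h2]
    ring
  · rw [segreIdeal, Ideal.span_le]
    rintro _ (⟨S, T, rfl⟩ | ⟨C₀, A, hC, hA, rfl⟩)
    · rw [SetLike.mem_coe, hker, map_sub, segreHom_X_mul_X, sub_self]
      exact Ideal.zero_mem _
    · rw [SetLike.mem_coe, hker, segreHom_circuitForm hA]
      exact Ideal.mul_mem_right _ _ (Ideal.subset_span ⟨C₀, hC, rfl⟩)

/-! ### The homogeneous vanishing ideal of the Schubert variety -/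

theorem eval_mk_rep_eq_zero_iff {σ : Type*} {k : ℕ} {F : MvPolynomial σ ℂ} (hF : F.IsHomogeneous k)
    (w : σ → ℂ) (hw : w ≠ 0) : eval (Projectivization.mk ℂ w hw).rep F = 0 ↔ eval w F = 0 := by
  obtain ⟨c, hc⟩ := Projectivization.exists_smul_eq_mk_rep ℂ w hw
  have : (Projectivization.mk ℂ w hw).rep = fun S => (c : ℂ) * w S := by
    rw [← hc]
    rfl
  rw [this, eval_smul_of_isHomogeneous hF, mul_eq_zero, or_iff_right (pow_ne_zero _ c.ne_zero)]

theorem subset_zariskiClosure (Y : Set (Fin n → ℙ ℂ (Fin 2 → ℂ))) : Y ⊆ zariskiClosure Y :=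
  fun p hp _ _ _ h => h p hp

theorem eval_segreCoord (w : Fin n → Fin 2 → ℂ) (F : MvPolynomial (Finset (Fin n)) ℂ) :
    eval (segreCoord w) F = eval (fun ik : Fin n × Fin 2 => w ik.1 ik.2) (segreHom n F) := by
  rw [eval_segreHom]
  rfl

theorem segreHom_X_isWeightedHomogeneous (S : Finset (Fin n)) :
    IsWeightedHomogeneous (multiWeight n) (segreHom n (X S)) 1 := by
  have h : ∀ (k : Fin 2) (T : Finset (Fin n)), IsWeightedHomogeneous (multiWeight n)
      (∏ i ∈ T, (X (i, k) : MvPolynomial (Fin n × Fin 2) ℂ)) (∑ i ∈ T, Pi.single i 1) :=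
    fun k T => IsWeightedHomogeneous.prod T _ _ fun i _ => isWeightedHomogeneous_X ℂ _ (i, k)
  have h1 := (h 0 S).mul (h 1 Sᶜ)
  rw [Finset.sum_add_sum_compl, Finset.univ_sum_single] at h1
  rw [segreHom, aeval_X]
  exact h1

/-- A form vanishing on `Y_L` vanishes at the affine points `([v_i : 1])`, whose Segre coordinates
are `∏_{i ∈ S} v_i`, and this suffices for membership. Conversely, the binomials vanish on the whole
Segre image, while the circuit forms pull back to multihomogeneous polynomials vanishing on the
image of `L`, hence on its closure. -/
theorem segreVanishingIdeal_eq (hα : IsCircuitChoice L α) :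
    segreVanishingIdeal L = segreIdeal L α := by
  refine le_antisymm ?_ ?_
  · rw [segreVanishingIdeal, projVanishingIdeal, Ideal.span_le]
    rintro F ⟨k, hF, hv⟩
    refine mem_segreIdeal_of_isHomogeneous hα hF fun v hvL => ?_
    have h1 := hv (segreMap (affineChart v))
      ⟨_, subset_zariskiClosure _ ⟨v, hvL, rfl⟩, rfl⟩
    have h2 : segreMap (affineChart v) = _ :=
      segreMap_mk (fun i => ![v i, 1]) (fun i h => one_ne_zero (congrFun h 1))
    rw [h2, eval_mk_rep_eq_zero_iff hF] at h1
    rw [← h1]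
    congr 2
    funext S
    simp [segreCoord]
  · rw [segreIdeal, Ideal.span_le]
    rintro _ (⟨S, T, rfl⟩ | ⟨C₀, A, hC, hA, rfl⟩)
    · have h2 : (X S * X T - X (S ∪ T) * X (S ∩ T) :
          MvPolynomial (Finset (Fin n)) ℂ).IsHomogeneous 2 :=
        ((isHomogeneous_X ℂ S).mul (isHomogeneous_X ℂ T)).sub
          ((isHomogeneous_X ℂ _).mul (isHomogeneous_X ℂ _))
      refine Ideal.subset_span ⟨2, h2, ?_⟩
      rintro _ ⟨p, -, rfl⟩
      rw [segreMap, eval_mk_rep_eq_zero_iff h2, eval_segreCoord, map_sub, segreHom_X_mul_X,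
        sub_self, map_zero]
    · have hhom : (circuitForm C₀ A (α C₀)).IsHomogeneous 1 := by
        refine IsHomogeneous.sum _ _ _ fun i _ => ?_
        have := (isHomogeneous_C (Finset (Fin n)) (α C₀ i)).mul (isHomogeneous_X ℂ (A ∪ {i}))
        rwa [zero_add] at this
      refine Ideal.subset_span ⟨1, hhom, ?_⟩
      rintro _ ⟨p, hp, rfl⟩
      rw [segreMap, eval_mk_rep_eq_zero_iff hhom, eval_segreCoord]
      refine hp 1 (segreHom n (circuitForm C₀ A (α C₀))) ?_ ?_
      · rw [circuitForm, map_sum]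
        refine IsWeightedHomogeneous.sum _ _ _ fun i _ => ?_
        rw [map_mul, ← algebraMap_eq, AlgHom.commutes, algebraMap_eq]
        have := (isWeightedHomogeneous_C (multiWeight n) (α C₀ i)).mul
          (segreHom_X_isWeightedHomogeneous (A ∪ {i}))
        rwa [zero_add] at this
      · rintro _ ⟨v, hvL, rfl⟩
        have hmem : circuitForm C₀ A (α C₀) ∈ segreIdeal L α :=
          Ideal.subset_span (Or.inr ⟨C₀, A, hC, hA, rfl⟩)
        have h0 := (mem_segreIdeal_iff hα).1 hmem v hvL 1
        -- Vanishing is known for the coordinates `(v_i, 1)` and has to be carried over to the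
        -- chosen representatives.
        have h1 : eval (segreCoord fun i => (affineChart v i).rep) (circuitForm C₀ A (α C₀)) = 0 := by
          have h2 : segreMap (affineChart v) = _ :=
            segreMap_mk (fun i => ![v i, 1]) (fun i h => one_ne_zero (congrFun h 1))
          rw [← eval_mk_rep_eq_zero_iff hhom _ (segreCoord_ne_zero _ fun i =>
            (affineChart v i).rep_nonzero)]
          change eval (segreMap (affineChart v)).rep _ = 0
          rw [h2, eval_mk_rep_eq_zero_iff hhom, ← h0]
          congr 2
          funext S
          simp [segreCoord]
        rw [eval_segreCoord] at h1
        exact h1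

end SchubertVariety

/-! ### The differentiation pairing -/

section Pairing

variable {d : ℕ}

theorem coeff_pderiv_pow (i : Fin d) (k : ℕ) (t : Fin d →₀ ℕ) (g : MvPolynomial (Fin d) ℂ) :
    coeff t ((((pderiv i).toLinearMap : Module.End ℂ (MvPolynomial (Fin d) ℂ)) ^ k) g) =
      ((t i + 1).ascFactorial k : ℂ) * coeff (t + Finsupp.single i k) g := by
  induction k generalizing g with
  | zero => simp
  | succ k ih =>
    have h : ((pderiv i).toLinearMap : Module.End ℂ (MvPolynomial (Fin d) ℂ)) g = pderiv i g := rfl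
    rw [pow_succ, Module.End.mul_apply, ih, h, coeff_pderiv,
      Nat.ascFactorial_succ, add_assoc, ← Finsupp.single_add]
    simp
    ring

theorem coeff_list_pderiv_prod (s : Fin d →₀ ℕ) (l : List (Fin d)) (hl : l.Nodup)
    (t : Fin d →₀ ℕ) (g : MvPolynomial (Fin d) ℂ) :
    coeff t ((l.map fun i =>
      ((pderiv i).toLinearMap : Module.End ℂ (MvPolynomial (Fin d) ℂ)) ^ s i).prod g) =
      (l.map fun i => ((t i + 1).ascFactorial (s i) : ℂ)).prod *
        coeff (t + (l.map fun i => Finsupp.single i (s i)).sum) g := by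
  induction l generalizing t with
  | nil => simp
  | cons i l ih =>
    rw [List.nodup_cons] at hl
    have h1 : (l.map fun j => (((t + Finsupp.single i (s i)) j + 1).ascFactorial (s j) : ℂ)) =
        l.map fun j => ((t j + 1).ascFactorial (s j) : ℂ) := by
      refine List.map_congr_left fun j hj => ?_
      have hij : i ≠ j := fun h => hl.1 (h ▸ hj)
      simp [hij]
    rw [List.map_cons, List.prod_cons, Module.End.mul_apply, coeff_pderiv_pow, ih hl.2, h1,
      List.map_cons, List.prod_cons, List.map_cons, List.sum_cons, add_assoc, mul_assoc]

/-- The product of the factorials of the exponents. -/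
def factorialProd (s : Fin d →₀ ℕ) : ℕ := ∏ i, (s i).factorial

/-- The pairing is thus diagonal on monomials with positive weights `∏ s_i!`. Orthogonality of
different degrees, the adjunction below and positivity all rest on this. -/
theorem constantCoeff_monomialDiff (s : Fin d →₀ ℕ) (g : MvPolynomial (Fin d) ℂ) :
    constantCoeff (monomialDiff s g) = factorialProd s * coeff s g := by
  rw [constantCoeff_eq, monomialDiff, coeff_list_pderiv_prod s _ (List.nodup_finRange d), zero_add,
    ← Fin.sum_univ_def, ← Fin.prod_univ_def, Finsupp.univ_sum_single]
  simp [factorialProd, Nat.one_ascFactorial]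

/-- The pairing `(f, g) ↦ (f(D) g)(0)`. -/
noncomputable def diffPairing (f g : MvPolynomial (Fin d) ℂ) : ℂ := constantCoeff (polyDiff f g)

theorem diffPairing_add_left (f f' g : MvPolynomial (Fin d) ℂ) :
    diffPairing (f + f') g = diffPairing f g + diffPairing f' g := by
  simp [diffPairing]

theorem diffPairing_add_right (f g g' : MvPolynomial (Fin d) ℂ) :
    diffPairing f (g + g') = diffPairing f g + diffPairing f g' := by
  simp [diffPairing]

theorem diffPairing_zero_right (f : MvPolynomial (Fin d) ℂ) : diffPairing f 0 = 0 := by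
  simp [diffPairing]

theorem diffPairing_smul_left (c : ℂ) (f g : MvPolynomial (Fin d) ℂ) :
    diffPairing (c • f) g = c * diffPairing f g := by
  rw [diffPairing, map_smul, LinearMap.smul_apply, smul_eq_C_mul, map_mul, constantCoeff_C,
    diffPairing]

theorem diffPairing_smul_right (c : ℂ) (f g : MvPolynomial (Fin d) ℂ) :
    diffPairing f (c • g) = c * diffPairing f g := by
  rw [diffPairing, map_smul, smul_eq_C_mul, map_mul, constantCoeff_C, diffPairing]

theorem diffPairing_sum_left {ι : Type*} (t : Finset ι) (f : ι → MvPolynomial (Fin d) ℂ)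
    (g : MvPolynomial (Fin d) ℂ) :
    diffPairing (∑ i ∈ t, f i) g = ∑ i ∈ t, diffPairing (f i) g := by
  simp [diffPairing, LinearMap.sum_apply]

theorem diffPairing_sum_right {ι : Type*} (t : Finset ι) (f : MvPolynomial (Fin d) ℂ)
    (g : ι → MvPolynomial (Fin d) ℂ) :
    diffPairing f (∑ i ∈ t, g i) = ∑ i ∈ t, diffPairing f (g i) := by
  simp [diffPairing]

theorem diffPairing_monomial_left (s : Fin d →₀ ℕ) (c : ℂ) (g : MvPolynomial (Fin d) ℂ) :
    diffPairing (monomial s c) g = c * (factorialProd s * coeff s g) := by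
  have h1 : monomial s c = c • monomial s (1 : ℂ) := by
    rw [smul_monomial, smul_eq_mul, mul_one]
  have h2 : polyDiff (monomial s (1 : ℂ)) = monomialDiff s := by
    have := (basisMonomials (Fin d) ℂ).constr_basis ℂ monomialDiff s
    rwa [coe_basisMonomials] at this
  rw [h1, diffPairing_smul_left, diffPairing, h2, constantCoeff_monomialDiff]

theorem diffPairing_eq_sum (f g : MvPolynomial (Fin d) ℂ) :
    diffPairing f g = ∑ s ∈ f.support, coeff s f * (factorialProd s * coeff s g) := by
  conv_lhs => rw [f.as_sum, diffPairing_sum_left]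
  exact Finset.sum_congr rfl fun s _ => diffPairing_monomial_left _ _ _

theorem factorialProd_add_single (s : Fin d →₀ ℕ) (i : Fin d) :
    factorialProd (s + Finsupp.single i 1) = (s i + 1) * factorialProd s := by
  rw [factorialProd, factorialProd, ← Finset.mul_prod_erase _ _ (Finset.mem_univ i),
    ← Finset.mul_prod_erase Finset.univ (fun i => (s i).factorial) (Finset.mem_univ i), ← mul_assoc]
  congr 1
  · simp [Nat.factorial_succ]
  · refine Finset.prod_congr rfl fun j hj => ?_
    simp [(Finset.ne_of_mem_erase hj).symm]

theorem diffPairing_X_mul (i : Fin d) (f g : MvPolynomial (Fin d) ℂ) :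
    diffPairing (X i * f) g = diffPairing f (pderiv i g) := by
  induction f using MvPolynomial.induction_on' with
  | monomial s c =>
    rw [X, monomial_mul, one_mul, add_comm, diffPairing_monomial_left, diffPairing_monomial_left,
      factorialProd_add_single, coeff_pderiv]
    push_cast
    ring
  | add f f' hf hf' => rw [mul_add, diffPairing_add_left, hf, hf', diffPairing_add_left]

/-- The linear form `∑ aᵢ xᵢ`. -/
noncomputable def linForm (a : Fin d → ℂ) : MvPolynomial (Fin d) ℂ := ∑ i, C (a i) * X i

/-- The derivative in the direction `a`. -/
noncomputable def dirDeriv (a : Fin d → ℂ) (g : MvPolynomial (Fin d) ℂ) : MvPolynomial (Fin d) ℂ :=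
  ∑ i, a i • pderiv i g

/-- This adjunction lets the factors of a product of linear forms be stripped off one at a time. -/
theorem diffPairing_linForm_mul (a : Fin d → ℂ) (f g : MvPolynomial (Fin d) ℂ) :
    diffPairing (linForm a * f) g = diffPairing f (dirDeriv a g) := by
  rw [linForm, dirDeriv, Finset.sum_mul, diffPairing_sum_left, diffPairing_sum_right]
  refine Finset.sum_congr rfl fun i _ => ?_
  rw [mul_assoc, ← smul_eq_C_mul, diffPairing_smul_left, diffPairing_X_mul, diffPairing_smul_right]

theorem linForm_isHomogeneous (a : Fin d → ℂ) : (linForm a).IsHomogeneous 1 := by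
  refine IsHomogeneous.sum _ _ _ fun i _ => ?_
  have := (isHomogeneous_C (Fin d) (a i)).mul (isHomogeneous_X ℂ i)
  rwa [zero_add] at this

theorem diffPairing_eq_zero_of_ne {k l : ℕ} {f g : MvPolynomial (Fin d) ℂ} (hf : f.IsHomogeneous k)
    (hg : g.IsHomogeneous l) (hkl : k ≠ l) : diffPairing f g = 0 := by
  rw [diffPairing_eq_sum]
  refine Finset.sum_eq_zero fun s hs => ?_
  have : coeff s g = 0 := by
    by_contra h
    exact hkl ((degree_of_mem_support hf hs).symm.trans
      (degree_of_mem_support hg (mem_support_iff.2 h)))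
  simp [this]

/-! ### Finite differences -/

/-- The polynomials all of whose monomials have degree at most `k - j`. -/
noncomputable abbrev degLE (d j k : ℕ) : Submodule ℂ (MvPolynomial (Fin d) ℂ) :=
  restrictSupport ℂ {t | t.degree + j ≤ k}

theorem mem_degLE {j k : ℕ} {f : MvPolynomial (Fin d) ℂ} :
    f ∈ degLE d j k ↔ ∀ t, coeff t f ≠ 0 → t.degree + j ≤ k := by
  rw [mem_restrictSupport_iff]
  simp [Set.subset_def]

theorem degLE_mono {j k k' : ℕ} (h : k ≤ k') : degLE d j k ≤ degLE d j k' :=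
  restrictSupport_mono ℂ fun _ ht => le_trans ht h

theorem degLE_succ (j k : ℕ) : degLE d j k ≤ degLE d (j + 1) (k + 1) :=
  restrictSupport_mono ℂ fun _ ht => Nat.succ_le_succ ht

theorem monomial_mul_mem_degLE {j k : ℕ} {f : MvPolynomial (Fin d) ℂ} (hf : f ∈ degLE d j k)
    (s : Fin d →₀ ℕ) (c : ℂ) : monomial s c * f ∈ degLE d j (k + s.degree) := by
  rw [mem_degLE] at hf ⊢
  intro t ht
  rw [coeff_monomial_mul'] at ht
  split_ifs at ht with h
  · have h1 := hf _ (right_ne_zero_of_mul ht)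
    have h2 : t.degree = (t - s).degree + s.degree := by
      rw [← map_add, tsub_add_cancel_of_le h]
    omega
  · exact absurd rfl ht

theorem X_mul_mem_degLE {j k : ℕ} {f : MvPolynomial (Fin d) ℂ} (hf : f ∈ degLE d j k)
    (i : Fin d) : X i * f ∈ degLE d j (k + 1) := by
  have := monomial_mul_mem_degLE hf (Finsupp.single i 1) 1
  rwa [Finsupp.degree_single] at this

theorem C_mul_mem_degLE {j k : ℕ} {f : MvPolynomial (Fin d) ℂ} (hf : f ∈ degLE d j k)
    (c : ℂ) : C c * f ∈ degLE d j k := by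
  rw [← smul_eq_C_mul]
  exact Submodule.smul_mem _ _ hf

theorem mem_degLE_totalDegree (f : MvPolynomial (Fin d) ℂ) : f ∈ degLE d 0 f.totalDegree := by
  rw [mem_degLE]
  intro t ht
  exact le_totalDegree (mem_support_iff.2 ht)

/-- The translatePoly `x ↦ f(x + a)` of a polynomial. -/
noncomputable def translatePoly (a : Fin d → ℂ) :
    MvPolynomial (Fin d) ℂ →ₐ[ℂ] MvPolynomial (Fin d) ℂ :=
  aeval fun i => X i + C (a i)

theorem eval_translate (a x : Fin d → ℂ) (f : MvPolynomial (Fin d) ℂ) :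
    eval x (translatePoly a f) = eval (x + a) f := by
  rw [translatePoly, aeval_def, ← coe_eval₂Hom, ← RingHom.comp_apply]
  congr 1
  refine ringHom_ext (fun r => by simp) fun i => ?_
  simp

theorem dirDeriv_X_mul (a : Fin d → ℂ) (i : Fin d) (g : MvPolynomial (Fin d) ℂ) :
    dirDeriv a (X i * g) = C (a i) * g + X i * dirDeriv a g := by
  simp only [dirDeriv, Derivation.leibniz, pderiv_X, smul_eq_mul, smul_add, Finset.sum_add_distrib]
  rw [add_comm, Finset.mul_sum]
  congr 1
  · rw [Finset.sum_eq_single i (by intro j _ hj; simp [hj]) (by simp)]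
    simp [smul_eq_C_mul]
  · refine Finset.sum_congr rfl fun j _ => ?_
    rw [mul_smul_comm]

/-- With `T` the translation, `T(x_i g) = x_i Tg + a_i Tg`, so each of the last two estimates for
`x_i g` uses the previous one for `g`; hence the joint induction. The defect is added to the degree
instead of subtracted from the bound, so a defect larger than the bound forces zero. -/
theorem translate_monomial_mem_degLE (a : Fin d → ℂ) (s : Fin d →₀ ℕ) (c : ℂ) :
    translatePoly a (monomial s c) ∈ degLE d 0 s.degree ∧
    translatePoly a (monomial s c) - monomial s c ∈ degLE d 1 s.degree ∧
    translatePoly a (monomial s c) - monomial s c - dirDeriv a (monomial s c) ∈ degLE d 2 s.degree := by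
  induction hk : s.degree generalizing s with
  | zero =>
    rw [Finsupp.degree_eq_zero_iff] at hk
    subst hk
    have h1 : translatePoly a (monomial 0 c) = monomial 0 c := by
      rw [← C_apply, ← algebraMap_eq, AlgHom.commutes]
    rw [h1, sub_self]
    refine ⟨(monomial_mem_restrictSupport ℂ).2 (Or.inl (by simp)), Submodule.zero_mem _, ?_⟩
    simp [dirDeriv]
  | succ k ih =>
    obtain ⟨i, hi⟩ : ∃ i, s i ≠ 0 := by
      by_contra! h
      have : s = 0 := Finsupp.ext h
      simp [this] at hk
    obtain ⟨t, rfl⟩ : ∃ t, s = t + Finsupp.single i 1 :=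
      ⟨s - Finsupp.single i 1, (tsub_add_cancel_of_le (by
        rw [Finsupp.single_le_iff]; omega)).symm⟩
    obtain ⟨h1, h2, h3⟩ := ih t (by simpa using hk)
    set g := monomial t c with hg
    have hm : monomial (t + Finsupp.single i 1) c = X i * g := by
      rw [X, hg, monomial_mul, one_mul, add_comm]
    have hT : translatePoly a (X i * g) = X i * translatePoly a g + C (a i) * translatePoly a g := by
      rw [map_mul, translatePoly, aeval_X, add_mul]
    rw [hm, hT, dirDeriv_X_mul]
    refine ⟨Submodule.add_mem _ (X_mul_mem_degLE h1 i)
      (degLE_mono (Nat.le_succ k) (C_mul_mem_degLE h1 _)), ?_, ?_⟩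
    · have : X i * translatePoly a g + C (a i) * translatePoly a g - X i * g =
          X i * (translatePoly a g - g) + C (a i) * translatePoly a g := by ring
      rw [this]
      exact Submodule.add_mem _ (X_mul_mem_degLE h2 i) (degLE_succ _ _ (C_mul_mem_degLE h1 _))
    · have : X i * translatePoly a g + C (a i) * translatePoly a g - X i * g -
          (C (a i) * g + X i * dirDeriv a g) =
          X i * (translatePoly a g - g - dirDeriv a g) + C (a i) * (translatePoly a g - g) := by ring
      rw [this]
      exact Submodule.add_mem _ (X_mul_mem_degLE h3 i) (degLE_succ _ _ (C_mul_mem_degLE h2 _))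

theorem dirDeriv_sum {ι : Type*} (a : Fin d → ℂ) (t : Finset ι) (f : ι → MvPolynomial (Fin d) ℂ) :
    dirDeriv a (∑ i ∈ t, f i) = ∑ i ∈ t, dirDeriv a (f i) := by
  simp only [dirDeriv, map_sum, Finset.smul_sum]
  exact Finset.sum_comm

theorem translate_sub_mem_degLE (a : Fin d → ℂ) {k : ℕ} {f : MvPolynomial (Fin d) ℂ}
    (hf : f ∈ degLE d 0 (k + 1)) : translatePoly a f - f ∈ degLE d 0 k := by
  have h : translatePoly a f - f ∈ degLE d 1 (k + 1) := by
    rw [f.as_sum, map_sum, ← Finset.sum_sub_distrib]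
    exact Submodule.sum_mem _ fun s hs => degLE_mono (mem_degLE.1 hf s (mem_support_iff.1 hs))
      (translate_monomial_mem_degLE a s _).2.1
  rw [mem_degLE] at h ⊢
  intro t ht
  have := h t ht
  omega

/-- The leading form of a finite difference is the derivative of the leading form. -/
theorem homogeneousComponent_translate_sub (a : Fin d → ℂ) {k : ℕ} {f : MvPolynomial (Fin d) ℂ}
    (hf : f ∈ degLE d 0 (k + 1)) :
    homogeneousComponent k (translatePoly a f - f) = dirDeriv a (homogeneousComponent (k + 1) f) := by
  have h : translatePoly a f - f - dirDeriv a f ∈ degLE d 2 (k + 1) := by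
    rw [f.as_sum, map_sum, dirDeriv_sum, ← Finset.sum_sub_distrib, ← Finset.sum_sub_distrib]
    exact Submodule.sum_mem _ fun s hs => degLE_mono (mem_degLE.1 hf s (mem_support_iff.1 hs))
      (translate_monomial_mem_degLE a s _).2.2
  have hcoeff : ∀ (t : Fin d →₀ ℕ) (g : MvPolynomial (Fin d) ℂ),
      coeff t (dirDeriv a g) = ∑ i, a i * (coeff (t + Finsupp.single i 1) g * (t i + 1)) := by
    intro t g
    simp [dirDeriv, coeff_sum, coeff_pderiv]
  ext t
  rw [coeff_homogeneousComponent, hcoeff]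
  simp only [coeff_homogeneousComponent, map_add, Finsupp.degree_single]
  by_cases ht : t.degree = k
  · simp only [ht, if_true]
    rw [← hcoeff, ← sub_eq_zero, ← coeff_sub]
    by_contra h0
    have := mem_degLE.1 h t h0
    omega
  · simp [ht]

/-- Removing a factor `l_i` replaces the leading form of `f` by its derivative along `a_i`, the
leading form of `f(x + a_i) - f(x)`. This difference vanishes at the partial sums for `p - e_i`, so
induction ends with a constant vanishing at the origin. -/
theorem diffPairing_prod_linForm_eq_zero {n : ℕ} (a : Fin n → Fin d → ℂ) (p : Fin n →₀ ℕ)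
    (f : MvPolynomial (Fin d) ℂ) (hf : f ∈ degLE d 0 p.degree)
    (hv : ∀ q ≤ p, eval (∑ j, (q j : ℂ) • a j) f = 0) :
    diffPairing (aeval (fun j => linForm (a j)) (monomial p (1 : ℂ)))
      (homogeneousComponent p.degree f) = 0 := by
  induction hk : p.degree generalizing p f with
  | zero =>
    rw [Finsupp.degree_eq_zero_iff] at hk
    subst hk
    have h1 : f = C (coeff 0 f) := by
      ext s
      rw [coeff_C]
      split_ifs with h
      · rw [h]
      · by_contra h2
        have := mem_degLE.1 hf s h2
        simp only [map_zero, add_zero, nonpos_iff_eq_zero, Finsupp.degree_eq_zero_iff] at this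
        exact h this.symm
    have h2 := hv 0 le_rfl
    rw [h1, eval_C] at h2
    rw [h1, h2]
    simp [diffPairing]
  | succ k ih =>
    obtain ⟨i, hi⟩ : ∃ i, p i ≠ 0 := by
      by_contra! h
      have : p = 0 := Finsupp.ext h
      simp [this] at hk
    obtain ⟨t, rfl⟩ : ∃ t, p = t + Finsupp.single i 1 :=
      ⟨p - Finsupp.single i 1, (tsub_add_cancel_of_le (by
        rw [Finsupp.single_le_iff]; omega)).symm⟩
    have ht : t.degree = k := by simpa using hk
    rw [hk] at hf
    have h1 : monomial (t + Finsupp.single i 1) (1 : ℂ) = X i * monomial t 1 := by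
      rw [X, monomial_mul, one_mul, add_comm]
    rw [h1, map_mul, aeval_X, diffPairing_linForm_mul, ← homogeneousComponent_translate_sub _ hf]
    refine ih t _ (ht ▸ translate_sub_mem_degLE _ hf) (fun q hq => ?_) ht
    have h2 : (∑ j, (q j : ℂ) • a j) + a i =
        ∑ j, ((q + Finsupp.single i 1 : Fin n →₀ ℕ) j : ℂ) • a j := by
      simp [add_smul, Finset.sum_add_distrib, Finsupp.single_apply]
    rw [map_sub, eval_translate, h2, hv _ (add_le_add_left hq _),
      hv q (hq.trans (le_add_of_nonneg_right zero_le)), sub_zero]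

/-! ### Harmonic spaces -/

theorem aeval_linForm_isHomogeneous {n : ℕ} (a : Fin n → Fin d → ℂ) (p : Fin n →₀ ℕ) :
    (aeval (fun j => linForm (a j)) (monomial p (1 : ℂ))).IsHomogeneous p.degree := by
  rw [aeval_monomial, map_one, one_mul, Finsupp.degree_apply, Finsupp.prod]
  have := IsHomogeneous.prod p.support (fun j => linForm (a j) ^ p j) (fun j => 1 * p j)
    (fun j _ => (linForm_isHomogeneous (a j)).pow (p j))
  simpa using this

theorem monomial_mul_homogeneousComponent (s : Fin d →₀ ℕ) (c : ℂ) (k : ℕ)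
    (f : MvPolynomial (Fin d) ℂ) :
    monomial s c * homogeneousComponent k f =
      homogeneousComponent (k + s.degree) (monomial s c * f) := by
  ext t
  rw [coeff_homogeneousComponent, coeff_monomial_mul', coeff_monomial_mul',
    coeff_homogeneousComponent]
  by_cases h : s ≤ t
  · have h2 : t.degree = (t - s).degree + s.degree := by
      rw [← map_add, tsub_add_cancel_of_le h]
    simp only [h, if_true, h2, add_left_inj]
    split_ifs <;> simp
  · simp [h]

/-- Products of linear forms lie in the inverse system of the associated graded ideal of a point
set that contains all partial sums of the directions of the forms. -/
theorem prod_linForm_mem_inverseSystem {n : ℕ} (a : Fin n → Fin d → ℂ) (p : Fin n →₀ ℕ)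
    (Y : Set (Fin d → ℂ)) (hY : ∀ q ≤ p, ∑ j, (q j : ℂ) • a j ∈ Y) :
    aeval (fun j => linForm (a j)) (monomial p (1 : ℂ)) ∈
      inverseSystem (grIdeal (vanishingIdeal ℂ Y)) := by
  intro g hg
  change diffPairing _ g = 0
  -- The pairing is not linear over the polynomial ring, so the induction over the ideal carries a
  -- multiplier `r`.
  suffices h : ∀ r, diffPairing (aeval (fun j => linForm (a j)) (monomial p (1 : ℂ))) (r * g) = 0 by
    simpa using h 1
  refine Submodule.span_induction (p := fun g _ => ∀ r, diffPairing
    (aeval (fun j => linForm (a j)) (monomial p (1 : ℂ))) (r * g) = 0) ?_ ?_ ?_ ?_ hg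
  · rintro _ ⟨f, hf, rfl⟩ r
    induction r using MvPolynomial.induction_on' with
    | monomial s c =>
      rw [monomial_mul_homogeneousComponent]
      by_cases hk : p.degree = f.totalDegree + s.degree
      · rw [← hk]
        -- A monomial times the leading form of `f` is the component of degree `|p|` of the product
        -- with `f`, which still vanishes on `Y`.
        refine diffPairing_prod_linForm_eq_zero a p _
          (hk ▸ monomial_mul_mem_degLE (mem_degLE_totalDegree f) s c) fun q hq => ?_
        have := mem_vanishingIdeal_iff.1 hf _ (hY q hq)
        rw [map_mul, ← coe_aeval_eq_eval, RingHom.coe_coe, this, mul_zero]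
      · exact diffPairing_eq_zero_of_ne (aeval_linForm_isHomogeneous a p)
          (homogeneousComponent_isHomogeneous _ _) hk
    | add r r' hr hr' => rw [add_mul, diffPairing_add_right, hr, hr', add_zero]
  · intro r
    rw [mul_zero, diffPairing_zero_right]
  · intro g g' _ _ hg hg' r
    rw [mul_add, diffPairing_add_right, hg, hg', add_zero]
  · intro c g _ hg r
    rw [smul_eq_mul, ← mul_assoc]
    exact hg _

/-- An element of the inverse system of the associated graded ideal of a set of real points is
determined by its values on this set. -/
theorem eq_zero_of_mem_inverseSystem {Y : Set (Fin d → ℂ)}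
    (hY : ∀ x ∈ Y, ∀ i, starRingEnd ℂ (x i) = x i) {f : MvPolynomial (Fin d) ℂ}
    (hf : f ∈ inverseSystem (grIdeal (vanishingIdeal ℂ Y))) (hv : ∀ x ∈ Y, eval x f = 0) :
    f = 0 := by
  -- The points are real, so the conjugate polynomial also vanishes on `Y`. Pairing `f` with its
  -- leading form gives a sum of terms `s! |f_s|²` over the top degree, which is positive unless `f
  -- = 0`.
  set g := map (starRingEnd ℂ) f with hg
  have hgI : g ∈ vanishingIdeal ℂ Y := by
    rw [mem_vanishingIdeal_iff]
    intro x hx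
    have h1 : (fun i => starRingEnd ℂ (x i)) = x := funext (hY x hx)
    have h2 : eval x g = starRingEnd ℂ (eval x f) := by
      rw [hg, eval_map, ← eval₂_id, hom_eval₂, RingHom.comp_id]
      congr 1
      exact h1.symm
    rw [← RingHom.coe_coe, coe_aeval_eq_eval, h2, hv x hx, map_zero]
  have h0 : diffPairing f (homogeneousComponent g.totalDegree g) = 0 :=
    hf _ (Ideal.subset_span ⟨g, hgI, rfl⟩)
  by_contra hne
  have hgne : g ≠ 0 := by
    rw [hg, Ne, map_eq_zero_iff _ (map_injective _ (RingHom.injective _))]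
    exact hne
  obtain ⟨s, hs, hdeg⟩ : ∃ s ∈ g.support, s.degree = g.totalDegree := by
    obtain ⟨s, hs, h⟩ := Finset.exists_mem_eq_sup g.support (support_nonempty.2 hgne)
      (fun s => s.sum fun _ e => e)
    exact ⟨s, hs, h.symm⟩
  rw [diffPairing_eq_sum] at h0
  have h1 : ∀ t ∈ f.support, coeff t f * (factorialProd t *
      coeff t (homogeneousComponent g.totalDegree g)) =
      ((if t.degree = g.totalDegree then factorialProd t * Complex.normSq (coeff t f) else 0 : ℝ) :
        ℂ) := by
    intro t _
    rw [coeff_homogeneousComponent, hg, coeff_map]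
    split_ifs
    · rw [mul_left_comm, Complex.mul_conj]
      push_cast
      rfl
    · simp
  rw [Finset.sum_congr rfl h1, ← Complex.ofReal_sum, Complex.ofReal_eq_zero,
    Finset.sum_eq_zero_iff_of_nonneg] at h0
  · have hsf : s ∈ f.support := by
      rw [mem_support_iff] at hs ⊢
      intro h
      rw [hg, coeff_map, h, map_zero] at hs
      exact hs rfl
    have h2 := h0 s hsf
    rw [if_pos hdeg, mul_eq_zero, Nat.cast_eq_zero, Complex.normSq_eq_zero] at h2
    rcases h2 with h2 | h2
    · exact (Finset.prod_pos fun i _ => Nat.factorial_pos (s i)).ne' h2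
    · exact mem_support_iff.1 hsf h2
  · intro t _
    split_ifs
    · exact mul_nonneg (Nat.cast_nonneg _) (Complex.normSq_nonneg _)
    · exact le_rfl

end Pairing

/-! ### Dimensions of spaces of bounded polynomials on a subspace -/

section Dimension

variable {n : ℕ}

/-- The restriction of polynomials to functions on `L`. -/
noncomputable def restrictTo (L : Submodule ℂ (Fin n → ℂ)) :
    MvPolynomial (Fin n) ℂ →ₗ[ℂ] (L → ℂ) where
  toFun F v := eval (v : Fin n → ℂ) F
  map_add' F G := by ext; simp
  map_smul' r F := by ext; simp

theorem restrictTo_apply (L : Submodule ℂ (Fin n → ℂ)) (F : MvPolynomial (Fin n) ℂ) (v : L) :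
    restrictTo L F v = eval (v : Fin n → ℂ) F := rfl

/-- The functions on `L` given by polynomials with exponents bounded by `c`. -/
noncomputable def boundedFun (L : Submodule ℂ (Fin n → ℂ)) (c : Fin n →₀ ℕ) :
    Submodule ℂ (L → ℂ) :=
  (boundedPoly c).map (restrictTo L)

instance boundedPoly_finite (c : Fin n →₀ ℕ) : Module.Finite ℂ (boundedPoly c) := by
  have : (Set.Iic c).Finite := by
    rw [← Set.Icc_bot]
    exact Set.finite_Icc _ _
  have := this.to_subtype
  exact Module.Finite.of_basis (basisRestrictSupport ℂ (Set.Iic c))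

instance boundedFun_finite (L : Submodule ℂ (Fin n → ℂ)) (c : Fin n →₀ ℕ) :
    Module.Finite ℂ (boundedFun L c) :=
  inferInstanceAs (Module.Finite ℂ ((boundedPoly c).map (restrictTo L)))

theorem boundedPoly_mono {c c' : Fin n →₀ ℕ} (h : c ≤ c') : boundedPoly c ≤ boundedPoly c' :=
  restrictSupport_mono ℂ (Set.Iic_subset_Iic.2 h)

theorem boundedFun_mono (L : Submodule ℂ (Fin n → ℂ)) {c c' : Fin n →₀ ℕ} (h : c ≤ c') :
    boundedFun L c ≤ boundedFun L c' :=
  Submodule.map_mono (boundedPoly_mono h)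

theorem one_le_finrank_boundedFun (L : Submodule ℂ (Fin n → ℂ)) (c : Fin n →₀ ℕ) :
    1 ≤ Module.finrank ℂ (boundedFun L c) := by
  rw [Submodule.one_le_finrank_iff, Submodule.ne_bot_iff]
  refine ⟨restrictTo L 1, ⟨1, (mem_boundedPoly.2 fun s hs => ?_), rfl⟩, fun h => ?_⟩
  · rw [coeff_one] at hs
    have : 0 = s := by
      by_contra h
      simp [h] at hs
    rw [← this]
    exact zero_le
  · have := congrFun h 0
    simp [restrictTo_apply] at this

theorem finrank_add_finrank_map_le {V W : Type*} [AddCommGroup V] [Module ℂ V] [AddCommGroup W]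
    [Module ℂ W] (ρ : V →ₗ[ℂ] W) {U U₀ : Submodule ℂ V} [Module.Finite ℂ U] (hU : U₀ ≤ U)
    (hρ : U₀ ≤ LinearMap.ker ρ) :
    Module.finrank ℂ U₀ + Module.finrank ℂ (U.map ρ) ≤ Module.finrank ℂ U := by
  have h1 := LinearMap.finrank_range_add_finrank_ker (ρ.domRestrict U)
  rw [LinearMap.range_domRestrict] at h1
  have h2 : Module.finrank ℂ U₀ = Module.finrank ℂ (U₀.comap U.subtype) :=
    (Submodule.comapSubtypeEquivOfLe hU).symm.finrank_eq
  have h3 : U₀.comap U.subtype ≤ LinearMap.ker (ρ.domRestrict U) := fun x hx => hρ hx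
  have h4 := Submodule.finrank_mono h3
  omega

/-- Deletion and restriction for the dimensions of the spaces of bounded functions. -/
theorem finrank_boundedFun_add_le (L : Submodule ℂ (Fin n → ℂ)) (c : Fin n →₀ ℕ) {i : Fin n}
    {u : Fin n → ℂ} (hu : u ∈ L) (hui : u i ≠ 0) :
    Module.finrank ℂ (boundedFun L c) +
      Module.finrank ℂ (boundedFun (L ⊓ LinearMap.ker (LinearMap.proj i)) c) ≤
      Module.finrank ℂ (boundedFun L (c + Finsupp.single i 1)) := by
  set L' := L ⊓ LinearMap.ker (LinearMap.proj i) with hL'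
  have hle : L' ≤ L := inf_le_left
  let ρ : (L → ℂ) →ₗ[ℂ] (L' → ℂ) := LinearMap.funLeft ℂ ℂ (Submodule.inclusion hle)
  let μ : (L → ℂ) →ₗ[ℂ] (L → ℂ) := LinearMap.mulLeft ℂ (fun v => (v : Fin n → ℂ) i)
  have hμ : ∀ F, μ (restrictTo L F) = restrictTo L (X i * F) := by
    intro F
    funext v
    simp [μ, restrictTo_apply]
  have hcc : c ≤ c + Finsupp.single i 1 := le_add_of_nonneg_right zero_le
  -- Multiplication by `x_i` embeds the functions bounded by `c` into the kernel of restriction to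
  -- `L'`, inside the functions bounded by `c + e_i`; the restriction of the latter contains all
  -- functions on `L'` bounded by `c`.
  have hinj : Module.finrank ℂ ((boundedFun L c).map μ) = Module.finrank ℂ (boundedFun L c) := by
    have hi : Function.Injective (μ.domRestrict (boundedFun L c)) := by
      rw [← LinearMap.ker_eq_bot, LinearMap.ker_eq_bot']
      rintro ⟨_, F, hF, rfl⟩ h
      rw [LinearMap.domRestrict_apply, hμ] at h
      ext v
      refine eval_eq_zero_of_X_mul hu hui (fun w hw => ?_) v v.2
      have := congrFun h ⟨w, hw⟩
      simpa [restrictTo_apply] using this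
    rw [← LinearMap.range_domRestrict]
    exact LinearMap.finrank_range_of_inj hi
  have h1 : (boundedFun L c).map μ ≤ boundedFun L (c + Finsupp.single i 1) := by
    rintro _ ⟨_, ⟨F, hF, rfl⟩, rfl⟩
    refine ⟨X i * F, mem_boundedPoly.2 fun s hs => ?_, (hμ F).symm⟩
    rw [mul_comm, coeff_mul_X'] at hs
    split_ifs at hs with h
    · have := mem_boundedPoly.1 hF _ hs
      rwa [tsub_le_iff_right] at this
    · exact absurd rfl hs
  have h2 : (boundedFun L c).map μ ≤ LinearMap.ker ρ := by
    rintro _ ⟨f, -, rfl⟩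
    rw [LinearMap.mem_ker]
    funext v
    have hv : (v : Fin n → ℂ) i = 0 := v.2.2
    simp [ρ, μ, LinearMap.funLeft, hv]
  have h3 : boundedFun L' c ≤ (boundedFun L (c + Finsupp.single i 1)).map ρ := by
    rintro _ ⟨F, hF, rfl⟩
    exact ⟨restrictTo L F, ⟨F, boundedPoly_mono hcc hF, rfl⟩, rfl⟩
  have h4 := finrank_add_finrank_map_le ρ h1 h2
  have h5 := Submodule.finrank_mono h3
  omega

end Dimension

/-! ### Lattice points of unimodular zonotopes -/

section LatticePoints

variable {d n : ℕ} (A : Matrix (Fin d) (Fin n) ℤ)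

/-- The integer vector `η` separates the column `i` of `A` from the columns in `K`. -/
def SeparatesColumn (K : Set (Fin n)) (i : Fin n) (η : Fin d → ℤ) : Prop :=
  (∀ j ∈ K, ∑ r, η r * A r j = 0) ∧ ∑ r, η r * A r i = 1

/-- The `j`-th column of `A`, as a real vector. -/
def realCol (j : Fin n) : Fin d → ℝ := fun r => (A r j : ℝ)

/-- The real span of the columns of `A` indexed by `K`. -/
def colSpan (K : Set (Fin n)) : Submodule ℝ (Fin d → ℝ) := Submodule.span ℝ (realCol A '' K)

variable {A}

theorem sum_mul_eq_zero_of_mem_colSpan {K : Set (Fin n)} {η : Fin d → ℤ}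
    (h : ∀ j ∈ K, ∑ r, η r * A r j = 0) {w : Fin d → ℝ} (hw : w ∈ colSpan A K) :
    ∑ r, (η r : ℝ) * w r = 0 := by
  refine Submodule.span_induction (p := fun w _ => ∑ r, (η r : ℝ) * w r = 0) ?_ ?_ ?_ ?_ hw
  · rintro _ ⟨j, hj, rfl⟩
    simp only [realCol]
    exact_mod_cast h j hj
  · simp
  · intro x y _ _ hx hy
    simp [mul_add, Finset.sum_add_distrib, hx, hy]
  · intro c x _ hx
    simp only [Pi.smul_apply, smul_eq_mul, mul_left_comm _ c, ← Finset.mul_sum, hx, mul_zero]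

/-- In a unimodular matrix every column can be separated by an integer vector from a set of columns
that does not span it. -/
theorem IsUnimodularMatrix.exists_separatesColumn (hA : IsUnimodularMatrix A) {K : Set (Fin n)}
    {i : Fin n} (hi : realCol A i ∉ colSpan A K) : ∃ η, SeparatesColumn A K i η := by
  have hempty : LinearIndepOn ℝ (realCol A) ∅ := linearIndepOn_empty ℝ _
  -- A column basis is built in stages: a basis of the span of `K`, then column `i`, then a
  -- completion. The resulting square minor is nonzero, hence `±1`, and the row of its integral
  -- inverse belonging to `i` is the separating vector.
  set J₀ := hempty.extend (Set.empty_subset K) with hJ₀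
  have hspan₀ : Submodule.span ℝ (realCol A '' J₀) = colSpan A K :=
    hempty.span_image_extend_eq_span_image _
  have hJ₁ : LinearIndepOn ℝ (realCol A) (insert i J₀) :=
    (hempty.linearIndepOn_extend _).insert (by rwa [hspan₀])
  set J := hJ₁.extend (Set.subset_univ _) with hJ
  have hJind : LinearIndepOn ℝ (realCol A) J := hJ₁.linearIndepOn_extend _
  have hJspan : Submodule.span ℝ (realCol A '' J) = Submodule.span ℝ (Set.range (realCol A)) := by
    rw [hJ, hJ₁.span_image_extend_eq_span_image, Set.image_univ]
  have hcols : (A.map (Int.cast : ℤ → ℝ)).col = realCol A := rfl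
  classical
  have hcard : Fintype.card J = Fintype.card (Fin d) := by
    have h1 := finrank_span_eq_card (R := ℝ) (b := fun j : J => realCol A j) hJind
    rw [← Set.image_eq_range, hJspan, ← hcols, ← Matrix.rank_eq_finrank_span_cols, hA.1] at h1
    rw [← h1, Fintype.card_fin]
  set e : Fin d ≃ J := (Fintype.equivOfCardEq hcard).symm with he
  set f : Fin d ↪ Fin n := e.toEmbedding.trans (Function.Embedding.subtype _) with hf
  set M := A.submatrix id f with hM
  have hMreal : IsUnit (M.map (Int.cast : ℤ → ℝ)) := by
    rw [← Matrix.linearIndependent_cols_iff_isUnit]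
    exact (linearIndependent_equiv e).2 hJind
  have hdet : M.det ≠ 0 := by
    intro h0
    rw [Matrix.isUnit_iff_isUnit_det, isUnit_iff_ne_zero] at hMreal
    refine hMreal ?_
    have := Int.cast_det M (R := ℝ)
    rw [← this, h0, Int.cast_zero]
  have hunit : IsUnit M.det := by
    have := hA.2 f
    rw [← hM] at this
    simp only [Set.mem_insert_iff, Set.mem_singleton_iff] at this
    rw [Int.isUnit_iff]
    tauto
  have hinv : M⁻¹ * M = 1 := Matrix.nonsing_inv_mul M hunit
  have hiJ : i ∈ J := hJ₁.subset_extend _ (Set.mem_insert i _)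
  have hmul : ∀ j (hj : j ∈ J), ∑ r, M⁻¹ (e.symm ⟨i, hiJ⟩) r * A r j = if i = j then 1 else 0 := by
    intro j hj
    have := congrFun (congrFun hinv (e.symm ⟨i, hiJ⟩)) (e.symm ⟨j, hj⟩)
    rw [Matrix.mul_apply, Matrix.one_apply] at this
    simpa [hM, hf] using this
  refine ⟨fun r => M⁻¹ (e.symm ⟨i, hiJ⟩) r, fun j hj => ?_, ?_⟩
  · have h0 : ∀ l ∈ J₀, ∑ r, M⁻¹ (e.symm ⟨i, hiJ⟩) r * A r l = 0 := by
      intro l hl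
      rw [hmul l (hJ₁.subset_extend _ (Set.mem_insert_of_mem _ hl)), if_neg]
      rintro rfl
      exact hi (hspan₀ ▸ Submodule.subset_span ⟨i, hl, rfl⟩)
    have hj' : realCol A j ∈ colSpan A J₀ := by
      rw [colSpan, hspan₀]
      exact Submodule.subset_span ⟨j, hj, rfl⟩
    have := sum_mul_eq_zero_of_mem_colSpan h0 hj'
    simp only [realCol] at this
    exact_mod_cast this
  · rw [hmul i hiJ, if_pos rfl]

/-! ### Counting lattice points by deletion and restriction -/

variable (A)

/-- The section of the row space of `A` by the coordinate hyperplanes indexed by `K`. -/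
def rowSection (K : Set (Fin n)) : Submodule ℂ (Fin n → ℂ) :=
  rowSpace A ⊓ ⨅ j ∈ K, LinearMap.ker (LinearMap.proj j)

/-- The real linear map defined by `A`. -/
noncomputable abbrev realMap : (Fin n → ℝ) →ₗ[ℝ] (Fin d → ℝ) :=
  (A.map (Int.cast : ℤ → ℝ)).mulVecLin

variable {A}

theorem realMap_single (i : Fin n) : realMap A (Pi.single i 1) = realCol A i := by
  rw [realMap, Matrix.mulVecLin_apply, Matrix.mulVec_single_one]
  rfl

theorem rowSection_insert (K : Set (Fin n)) (i : Fin n) :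
    rowSection A (insert i K) = rowSection A K ⊓ LinearMap.ker (LinearMap.proj i) := by
  rw [rowSection, rowSection, iInf_insert, inf_comm (LinearMap.ker _), inf_assoc]

/-- The combination of the rows of `A` with coefficients `η` has entry `0` at each index in `K` and
entry `1` at `i`. -/
theorem SeparatesColumn.exists_mem_rowSection {K : Set (Fin n)} {i : Fin n} {η : Fin d → ℤ}
    (hη : SeparatesColumn A K i η) : ∃ u ∈ rowSection A K, u i ≠ 0 := by
  set u : Fin n → ℂ := ∑ r, (η r : ℂ) • (A.map (Int.cast : ℤ → ℂ)).row r with hu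
  have hval : ∀ j, u j = ((∑ r, η r * A r j : ℤ) : ℂ) := by
    intro j
    simp [hu, Finset.sum_apply]
  refine ⟨u, ⟨Submodule.sum_mem _ fun r _ => Submodule.smul_mem _ _
    (Submodule.subset_span ⟨r, rfl⟩), ?_⟩, ?_⟩
  · simp only [SetLike.mem_coe, Submodule.mem_iInf, LinearMap.mem_ker, LinearMap.proj_apply]
    intro j hj
    rw [hval, hη.1 j hj, Int.cast_zero]
  · rw [hval, hη.2, Int.cast_one]
    exact one_ne_zero

/-- The lattice points in a zonotope with side lengths `c`, modulo the span of the columns in `K`,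
are at most as many as the dimension of the space of functions bounded by `c`. -/
theorem card_latticePoints_le
    (hA : ∀ (K : Set (Fin n)) (i : Fin n), realCol A i ∉ colSpan A K → ∃ η, SeparatesColumn A K i η)
    (c : Fin n →₀ ℕ) (K : Set (Fin n)) (Y : Finset (Fin d → ℤ))
    (hY : ∀ b ∈ Y, ∃ t : Fin n → ℝ, (∀ j, 0 ≤ t j ∧ t j ≤ c j) ∧
      (fun r => (b r : ℝ)) - realMap A t ∈ colSpan A K)
    (hinj : ∀ b ∈ Y, ∀ b' ∈ Y,
      (fun r => (b r : ℝ)) - (fun r => (b' r : ℝ)) ∈ colSpan A K → b = b') :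
    Y.card ≤ Module.finrank ℂ (boundedFun (rowSection A K) c) := by
  classical
  induction hk : c.degree generalizing c K Y with
  | zero =>
    rw [Finsupp.degree_eq_zero_iff] at hk
    subst hk
    -- With all sides zero, every point is zero modulo the span, so there is at most one; the
    -- constants give dimension at least one.
    refine le_trans (Finset.card_le_one.2 fun b hb b' hb' => ?_) (one_le_finrank_boundedFun _ _)
    obtain ⟨t, ht, h⟩ := hY b hb
    obtain ⟨t', ht', h'⟩ := hY b' hb'
    have h0 : t = 0 := funext fun j => le_antisymm (by simpa using (ht j).2) (ht j).1
    have h0' : t' = 0 := funext fun j => le_antisymm (by simpa using (ht' j).2) (ht' j).1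
    rw [h0, map_zero, sub_zero] at h
    rw [h0', map_zero, sub_zero] at h'
    exact hinj b hb b' hb' (Submodule.sub_mem _ h h')
  | succ k ih =>
    obtain ⟨i, hi⟩ : ∃ i, c i ≠ 0 := by
      by_contra! h
      have : c = 0 := Finsupp.ext h
      simp [this] at hk
    obtain ⟨c, rfl⟩ : ∃ c', c = c' + Finsupp.single i 1 :=
      ⟨c - Finsupp.single i 1, (tsub_add_cancel_of_le (by
        rw [Finsupp.single_le_iff]; omega)).symm⟩
    have hck : c.degree = k := by simpa using hk
    have hcc : c ≤ c + Finsupp.single i 1 := le_add_of_nonneg_right zero_le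
    -- shortening the side `i`
    have hshort : ∀ t : Fin n → ℝ, (∀ j, 0 ≤ t j ∧ t j ≤ ((c + Finsupp.single i 1 : Fin n →₀ ℕ) j : ℝ)) →
        ∃ s : ℝ, 0 ≤ s ∧ s ≤ 1 ∧ (c i < t i → 0 < s) ∧
          (∀ j, 0 ≤ (t - s • Pi.single i 1 : Fin n → ℝ) j ∧
            (t - s • Pi.single i 1 : Fin n → ℝ) j ≤ c j) := by
      intro t ht
      have hti := (ht i).2
      simp only [Finsupp.add_apply, Finsupp.single_eq_same, Nat.cast_add, Nat.cast_one] at hti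
      -- The amount removed is the excess over the shortened side.
      refine ⟨max (t i - c i) 0, le_max_right _ _, max_le (by linarith) zero_le_one,
        fun h => lt_max_of_lt_left (by linarith), fun j => ?_⟩
      by_cases hj : j = i
      · subst hj
        simp only [Pi.sub_apply, Pi.smul_apply, Pi.single_eq_same, smul_eq_mul, mul_one]
        have h0 := (ht j).1
        have hc0 : (0 : ℝ) ≤ c j := Nat.cast_nonneg _
        rcases max_cases (t j - c j) 0 with ⟨h, h'⟩ | ⟨h, h'⟩ <;> rw [h] <;>
          constructor <;> linarith
      · simpa [hj, Finsupp.single_apply, Ne.symm hj] using ht j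
    by_cases hmem : realCol A i ∈ colSpan A K
    · refine le_trans (ih c K Y (fun b hb => ?_) hinj hck)
        (Submodule.finrank_mono (boundedFun_mono _ hcc))
      obtain ⟨t, ht, h⟩ := hY b hb
      obtain ⟨s, -, -, -, hs⟩ := hshort t ht
      refine ⟨_, hs, ?_⟩
      rw [map_sub, map_smul, realMap_single, sub_sub_eq_add_sub, add_comm, add_sub_assoc]
      exact Submodule.add_mem _ (Submodule.smul_mem _ _ hmem) h
    obtain ⟨η, hη⟩ := hA K i hmem
    obtain ⟨u, hu, hui⟩ := hη.exists_mem_rowSection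
    have hdim := finrank_boundedFun_add_le (rowSection A K) c hu hui
    rw [← rowSection_insert] at hdim
    -- `P` selects the points that remain after shortening side `i`. The others stay distinct modulo
    -- column `i` as well, which matches the two terms of `hdim`.
    set P : (Fin d → ℤ) → Prop := fun b => ∃ t : Fin n → ℝ, (∀ j, 0 ≤ t j ∧ t j ≤ c j) ∧
      (fun r => (b r : ℝ)) - realMap A t ∈ colSpan A K with hP
    have h1 : (Y.filter P).card ≤ Module.finrank ℂ (boundedFun (rowSection A K) c) :=
      ih c K _ (fun b hb => (Finset.mem_filter.1 hb).2)
        (fun b hb b' hb' => hinj b (Finset.mem_filter.1 hb).1 b' (Finset.mem_filter.1 hb').1) hck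
    have hle : colSpan A K ≤ colSpan A (insert i K) :=
      Submodule.span_mono (Set.image_mono (Set.subset_insert i K))
    have himem : realCol A i ∈ colSpan A (insert i K) :=
      Submodule.subset_span ⟨i, Set.mem_insert i K, rfl⟩
    -- points on a common line in direction `i` that are not in the smaller zonotope agree
    have hline : ∀ b ∈ Y, ∀ b' ∈ Y, ¬ P b' → ∀ (r : ℝ) (w : Fin d → ℝ), w ∈ colSpan A K →
        (fun r => (b r : ℝ)) - (fun r => (b' r : ℝ)) = w + r • realCol A i → ¬ 1 ≤ r := by
      intro b hb b' hb' hnP r w hw hbb hr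
      obtain ⟨t, ht, h⟩ := hY b hb
      obtain ⟨t', ht', h'⟩ := hY b' hb'
      obtain ⟨s, hs0, hs1, -, hs⟩ := hshort t ht
      obtain ⟨s', hs0', hs1', hspos, hs'⟩ := hshort t' ht'
      have hpos : 0 < s' := by
        refine hspos ?_
        by_contra hlt
        refine hnP ⟨t', fun j => ⟨(ht' j).1, ?_⟩, h'⟩
        by_cases hj : j = i
        · subst hj
          exact not_lt.1 hlt
        · simpa [Finsupp.single_apply, Ne.symm hj] using (ht' j).2
      -- Modulo the span of `K`, both `b - s a_i ≡ b' + (r - s) a_i` and `b' - s' a_i` lie in the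
      -- smaller zonotope, and `r - s ≥ 0`. So `b'` is their convex combination with weights `l` and
      -- `1 - l`, against `¬ P b'`.
      have hden : 0 < r - s + s' := by linarith
      set l : ℝ := s' / (r - s + s') with hl
      have hl0 : 0 ≤ l := div_nonneg hpos.le hden.le
      have hl1 : l ≤ 1 := (div_le_one hden).2 (by linarith)
      have hlrel : l * (r - s) - (1 - l) * s' = 0 := by
        rw [hl]
        field_simp
        ring
      refine hnP ⟨l • (t - s • Pi.single i 1) + (1 - l) • (t' - s' • Pi.single i 1),
        fun j => ⟨?_, ?_⟩, ?_⟩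
      · have h1 := mul_nonneg hl0 (hs j).1
        have h2 := mul_nonneg (sub_nonneg.2 hl1) (hs' j).1
        simpa only [Pi.add_apply, Pi.smul_apply, smul_eq_mul] using add_nonneg h1 h2
      · have h1 := mul_le_mul_of_nonneg_left (hs j).2 hl0
        have h2 := mul_le_mul_of_nonneg_left (hs' j).2 (sub_nonneg.2 hl1)
        rw [Pi.add_apply, Pi.smul_apply, Pi.smul_apply, smul_eq_mul, smul_eq_mul]
        linarith
      · rw [map_add, map_smul, map_smul, map_sub, map_sub, map_smul, map_smul, realMap_single]
        have key : (fun r => (b' r : ℝ)) - (l • (realMap A t - s • realCol A i) +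
            (1 - l) • (realMap A t' - s' • realCol A i)) =
            l • (((fun r => (b r : ℝ)) - realMap A t) - w) +
              (1 - l) • ((fun r => (b' r : ℝ)) - realMap A t') := by
          linear_combination (norm := module) (-l) • hbb - hlrel • realCol A i
        rw [key]
        exact Submodule.add_mem _ (Submodule.smul_mem _ _ (Submodule.sub_mem _ h hw))
          (Submodule.smul_mem _ _ h')
    have h2 : (Y.filter fun b => ¬ P b).card ≤
        Module.finrank ℂ (boundedFun (rowSection A (insert i K)) c) := by
      refine ih c _ _ (fun b hb => ?_) (fun b hb b' hb' hbb => ?_) hck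
      · obtain ⟨t, ht, h⟩ := hY b (Finset.mem_filter.1 hb).1
        obtain ⟨s, -, -, -, hs⟩ := hshort t ht
        refine ⟨_, hs, ?_⟩
        rw [map_sub, map_smul, realMap_single, sub_sub_eq_add_sub, add_comm, add_sub_assoc]
        exact Submodule.add_mem _ (Submodule.smul_mem _ _ himem) (hle h)
      · rw [colSpan, Set.image_insert_eq, Submodule.mem_span_insert] at hbb
        obtain ⟨r, w, hw, hbw⟩ := hbb
        have hbw : (fun r => (b r : ℝ)) - (fun r => (b' r : ℝ)) = w + r • realCol A i := by
          rw [hbw, add_comm]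
        -- Pairing with the separating vector shows that `r` is an integer; `hline` in both
        -- directions then leaves only `r = 0`.
        have hr : r = ((∑ q, η q * (b q - b' q) : ℤ) : ℝ) := by
          have h1 : ∑ q, (η q : ℝ) * ((fun r => (b r : ℝ)) - (fun r => (b' r : ℝ))) q =
              ∑ q, (η q : ℝ) * (w + r • realCol A i) q := by rw [hbw]
          have h2 : ∑ q, (η q : ℝ) * realCol A i q = 1 := by
            simp only [realCol]
            exact_mod_cast hη.2
          have h3 := sum_mul_eq_zero_of_mem_colSpan hη.1 hw
          simp only [Pi.add_apply, Pi.smul_apply, smul_eq_mul, mul_add, Finset.sum_add_distrib, h3,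
            mul_left_comm _ r, ← Finset.mul_sum, h2, zero_add, mul_one, Pi.sub_apply] at h1
          rw [← h1]
          push_cast
          rfl
        obtain ⟨hbY, hbP⟩ := Finset.mem_filter.1 hb
        obtain ⟨hbY', hbP'⟩ := Finset.mem_filter.1 hb'
        have hlt := hline b hbY b' hbY' hbP' r w hw hbw
        have hlt' := hline b' hbY' b hbY hbP (-r) (-w) (Submodule.neg_mem _ hw) (by
          rw [← neg_sub, hbw, neg_add, neg_smul])
        have hr0 : r = 0 := by
          rw [hr] at hlt hlt' ⊢
          norm_cast at hlt hlt' ⊢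
          omega
        refine hinj b hbY b' hbY' ?_
        rw [hbw, hr0, zero_smul, add_zero]
        exact hw
    have h3 := Finset.card_filter_add_card_filter_not (s := Y) P
    omega

end LatticePoints

/-! ### The harmonic algebra of a unimodular zonotope -/

section HarmonicAlgebra

variable {d n : ℕ} (A : Matrix (Fin d) (Fin n) ℤ)

/-- The `j`-th column of `A`, as a complex vector. -/
def complexCol (j : Fin n) : Fin d → ℂ := fun r => (A r j : ℂ)

/-- The algebra map that sends `x_j` to the linear form given by the `j`-th column of `A`. -/
noncomputable def colHom : MvPolynomial (Fin n) ℂ →ₐ[ℂ] MvPolynomial (Fin d) ℂ :=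
  aeval fun j => linForm (complexCol A j)

variable {A}

theorem eval_linForm (a y : Fin d → ℂ) : eval y (linForm a) = ∑ r, a r * y r := by
  simp [linForm]

theorem eval_colHom (y : Fin d → ℂ) (F : MvPolynomial (Fin n) ℂ) :
    eval y (colHom A F) = eval (fun j => eval y (linForm (complexCol A j))) F := by
  rw [colHom, aeval_def, ← coe_eval₂Hom, ← RingHom.comp_apply]
  congr 1
  refine ringHom_ext (fun r => by simp) fun S => ?_
  simp

theorem mem_rowSpace_iff {v : Fin n → ℂ} :
    v ∈ rowSpace A ↔ ∃ y : Fin d → ℂ, v = fun j => eval y (linForm (complexCol A j)) := by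
  rw [rowSpace, Submodule.mem_span_range_iff_exists_fun]
  have h : ∀ y : Fin d → ℂ, ∑ r, y r • (A.map (Int.cast : ℤ → ℂ)).row r =
      fun j => eval y (linForm (complexCol A j)) := by
    intro y
    funext j
    simp [eval_linForm, complexCol, Finset.sum_apply, mul_comm]
  simp only [h, eq_comm]

theorem rowSection_empty : rowSection A ∅ = rowSpace A := by
  simp [rowSection]

/-- Points of the row space have the form `(l_j(y))_j`, so restricting a polynomial to the row space
factors through substituting the forms `l_j`. -/
theorem finrank_boundedFun_le (c : Fin n →₀ ℕ) :
    Module.finrank ℂ (boundedFun (rowSpace A) c) ≤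
      Module.finrank ℂ ((boundedPoly c).map (colHom A).toLinearMap) := by
  choose y hy using fun v : rowSpace A => mem_rowSpace_iff.1 v.2
  let ρ : MvPolynomial (Fin d) ℂ →ₗ[ℂ] (rowSpace A → ℂ) :=
    { toFun := fun G v => eval (y v) G
      map_add' := fun F G => by ext; simp
      map_smul' := fun r F => by ext; simp }
  have h : boundedFun (rowSpace A) c = ((boundedPoly c).map (colHom A).toLinearMap).map ρ := by
    rw [← Submodule.map_comp, boundedFun]
    congr 1
    refine LinearMap.ext fun F => ?_
    funext v
    rw [restrictTo_apply]
    refine Eq.trans ?_ (eval_colHom (y v) F).symm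
    rw [← hy v]
  rw [h]
  exact Submodule.finrank_map_le _ _

theorem sum_mem_latticeLocus {m : ℕ} {q : Fin n →₀ ℕ} (hq : q ≤ constExp n m) :
    ∑ j, (q j : ℂ) • complexCol A j ∈ latticeLocus ((fun v => (m : ℝ) • v) '' zonotope A) := by
  refine ⟨fun r => ∑ j, q j * A r j, ?_, ?_⟩
  · refine ⟨_, ⟨fun j => (q j : ℝ) / m, ⟨fun j => by positivity, fun j => ?_⟩, rfl⟩, ?_⟩
    · exact div_le_one_of_le₀ (Nat.cast_le.2 (hq j : q j ≤ m)) (Nat.cast_nonneg _)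
    · funext r
      simp only [Pi.smul_apply, smul_eq_mul, Matrix.mulVec, dotProduct, Matrix.map_apply,
        Finset.mul_sum]
      push_cast
      refine Finset.sum_congr rfl fun j _ => ?_
      -- For `m = 0` the quotient `q j / m` is `0` by convention, which is harmless since then `q j
      -- = 0`.
      by_cases hm : m = 0
      · have := hq j
        rw [constExp_apply] at this
        have h0 : q j = 0 := by omega
        simp [h0]
      · field_simp
  · funext r
    simp [complexCol, Finset.sum_apply]

theorem boundedPoly_map_le_harmonicSpace (m : ℕ) :
    (boundedPoly (constExp n m)).map (colHom A).toLinearMap ≤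
      harmonicSpace ((fun v => (m : ℝ) • v) '' zonotope A) := by
  rw [boundedPoly, restrictSupport_eq_span, Submodule.map_span_le]
  rintro _ ⟨p, hp, rfl⟩
  exact prod_linForm_mem_inverseSystem _ p _ fun q hq => sum_mem_latticeLocus (hq.trans hp)

/-- The harmonic space of a dilated unimodular zonotope is spanned by products of the linear forms
given by the columns. -/
theorem harmonicSpace_eq (hA : IsUnimodularMatrix A) (m : ℕ) :
    harmonicSpace ((fun v => (m : ℝ) • v) '' zonotope A) =
      (boundedPoly (constExp n m)).map (colHom A).toLinearMap := by
  set Q := (fun v => (m : ℝ) • v) '' zonotope A with hQ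
  set B := (boundedPoly (constExp n m)).map (colHom A).toLinearMap with hB
  set N := Module.finrank ℂ B with hN
  set S : Set (Fin d → ℤ) := {p | (fun i => (p i : ℝ)) ∈ Q} with hS
  -- A bound for every finite subset also yields that the set of lattice points is finite.
  have hcard : ∀ Y : Finset (Fin d → ℤ), (Y : Set (Fin d → ℤ)) ⊆ S → Y.card ≤ N := by
    intro Y hY
    refine le_trans ?_ (finrank_boundedFun_le _)
    rw [← rowSection_empty]
    refine card_latticePoints_le (fun K i => hA.exists_separatesColumn) _ ∅ Y (fun b hb => ?_)
      fun b _ b' _ h => ?_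
    · obtain ⟨_, ⟨t, ht, rfl⟩, htb⟩ := hY hb
      refine ⟨(m : ℝ) • t, fun j => ⟨?_, ?_⟩, ?_⟩
      · exact mul_nonneg (Nat.cast_nonneg m) (ht.1 j)
      · exact mul_le_of_le_one_right (Nat.cast_nonneg m) (ht.2 j)
      · rw [map_smul, ← htb]
        change (m : ℝ) • (A.map (Int.cast : ℤ → ℝ)).mulVec t -
          (m : ℝ) • (A.map (Int.cast : ℤ → ℝ)).mulVec t ∈ _
        rw [sub_self]
        exact Submodule.zero_mem _
    · rw [colSpan, Set.image_empty, Submodule.span_empty, Submodule.mem_bot, sub_eq_zero] at h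
      funext r
      exact_mod_cast congrFun h r
  have hfin : S.Finite := by
    by_contra hinf
    obtain ⟨Y, hYS, hY⟩ := Set.Infinite.exists_subset_card_eq hinf (N + 1)
    have := hcard Y hYS
    omega
  have := hfin.fintype
  -- Evaluation at the lattice points is injective, so the harmonic space has dimension at most `N`,
  -- the dimension of the subspace `B`.
  let ev : harmonicSpace Q →ₗ[ℂ] (S → ℂ) :=
    { toFun := fun f b => eval (fun i => ((b : Fin d → ℤ) i : ℂ)) (f : MvPolynomial (Fin d) ℂ)
      map_add' := fun F G => by ext; simp
      map_smul' := fun r F => by ext; simp }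
  have hinj : Function.Injective ev := by
    rw [← LinearMap.ker_eq_bot, LinearMap.ker_eq_bot']
    rintro ⟨f, hf⟩ h
    ext1
    refine eq_zero_of_mem_inverseSystem ?_ hf ?_
    · rintro _ ⟨p, -, rfl⟩ i
      simp
    · rintro _ ⟨p, hp, rfl⟩
      exact congrFun h ⟨p, hp⟩
  have hfd : Module.Finite ℂ (harmonicSpace Q) := Module.Finite.of_injective ev hinj
  refine (Submodule.eq_of_le_of_finrank_le (boundedPoly_map_le_harmonicSpace m) ?_).symm
  have h1 := LinearMap.finrank_le_finrank_of_injective hinj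
  rw [Module.finrank_fintype_fun_eq_card, ← Set.toFinset_card] at h1
  exact h1.trans (hcard _ (by simp))

/-! ### Presentation of the harmonic algebra -/

variable (A)

/-- The algebra map `z_S ↦ x₀ ∏_{j ∈ S} l_j`. -/
noncomputable def zonotopeHom :
    MvPolynomial (Finset (Fin n)) ℂ →ₐ[ℂ] MvPolynomial (Fin (d + 1)) ℂ :=
  aeval fun S => X 0 * rename Fin.succ (colHom A (monomial (setExp S) 1))

variable {A}

theorem zonotopeHom_eq_shiftMap {k : ℕ} {F : MvPolynomial (Finset (Fin n)) ℂ}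
    (hF : F.IsHomogeneous k) :
    zonotopeHom A F = shiftMap d k (colHom A (dehomogenize n F)) := by
  conv_lhs => rw [F.as_sum]
  conv_rhs => rw [F.as_sum]
  simp only [map_sum]
  refine Finset.sum_congr rfl fun s hs => ?_
  rw [zonotopeHom, dehomogenize, aeval_monomial, aeval_monomial, shiftMap]
  simp only [LinearMap.comp_apply, LinearMap.mulLeft_apply, AlgHom.toLinearMap_apply, map_mul,
    AlgHom.commutes, Finsupp.prod, mul_pow, Finset.prod_mul_distrib, map_prod, map_pow]
  rw [Finset.prod_pow_eq_pow_sum, ← Finsupp.degree_apply, degree_of_mem_support hF hs]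
  ring

/-- In degree `k` the image consists of `x_0^k` times the substitutions of polynomials with
exponents at most `k`: dehomogenization respects this bound, and standard monomials attain every
bounded exponent. -/
theorem range_zonotopeHom (hA : IsUnimodularMatrix A) :
    Subalgebra.toSubmodule (zonotopeHom A).range = harmonicAlgebra (zonotope A) := by
  refine le_antisymm ?_ ?_
  · rintro _ ⟨F, rfl⟩
    change zonotopeHom A F ∈ _
    rw [← sum_homogeneousComponent F, map_sum]
    refine Submodule.sum_mem _ fun k _ => ?_
    have hk := homogeneousComponent_isHomogeneous k F
    rw [zonotopeHom_eq_shiftMap hk]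
    refine Submodule.mem_iSup_of_mem k ⟨_, ?_, rfl⟩
    rw [harmonicSpace_eq hA]
    exact ⟨_, dehomogenize_mem_boundedPoly hk, rfl⟩
  · refine iSup_le fun m => ?_
    rw [harmonicSpace_eq hA, boundedPoly, restrictSupport_eq_span, ← Submodule.map_comp,
      Submodule.map_span_le]
    rintro _ ⟨p, hp, rfl⟩
    refine ⟨chainMonomial m p, ?_⟩
    change zonotopeHom A _ = _
    rw [zonotopeHom_eq_shiftMap (chainMonomial_isHomogeneous p), dehomogenize_chainMonomial hp]
    rfl

/-- At the point `(t, y)` the image of `z_S` takes the value `t ∏_{j ∈ S} l_j(y)`, and `(l_j(y))_j`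
runs through the row space. So the map parametrizes the cone that defines `I_L^SE`. -/
theorem ker_zonotopeHom {α : Finset (Fin n) → Fin n → ℂ} (hα : IsCircuitChoice (rowSpace A) α) :
    RingHom.ker (zonotopeHom A) = segreIdeal (rowSpace A) α := by
  have heval : ∀ (x : Fin (d + 1) → ℂ) (F : MvPolynomial (Finset (Fin n)) ℂ),
      eval x (zonotopeHom A F) = eval (fun S => x 0 *
        ∏ j ∈ S, eval (fun r => x (Fin.succ r)) (linForm (complexCol A j))) F := by
    intro x F
    rw [zonotopeHom, aeval_def, ← coe_eval₂Hom, ← RingHom.comp_apply]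
    congr 1
    refine ringHom_ext (fun r => by simp) fun S => ?_
    simp [eval_rename, eval_colHom, monomial_setExp, Function.comp_def]
  ext F
  rw [RingHom.mem_ker, mem_segreIdeal_iff hα]
  constructor
  · intro h v hv t
    obtain ⟨y, rfl⟩ := mem_rowSpace_iff.1 hv
    have := heval (Fin.cons t y) F
    rw [h, map_zero] at this
    simpa using this.symm
  · intro h
    refine MvPolynomial.funext fun x => ?_
    rw [heval, map_zero]
    exact h _ (mem_rowSpace_iff.2 ⟨_, rfl⟩) _

theorem zonotopeHom_X_isWeightedHomogeneous (S : Finset (Fin n)) :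
    IsWeightedHomogeneous (xWeight d) (zonotopeHom A (X S)) (zWeight n S) := by
  have hlin : ∀ a : Fin d → ℂ,
      IsWeightedHomogeneous (xWeight d) (rename Fin.succ (linForm a)) (0, 1) := by
    intro a
    rw [linForm, map_sum]
    refine IsWeightedHomogeneous.sum _ _ _ fun r _ => ?_
    rw [map_mul, rename_C, rename_X]
    have := (isWeightedHomogeneous_C (xWeight d) (a r)).mul
      (isWeightedHomogeneous_X ℂ (xWeight d) (Fin.succ r))
    rwa [zero_add] at this
  have h1 := (isWeightedHomogeneous_X ℂ (xWeight d) 0).mul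
    (IsWeightedHomogeneous.prod S (fun j => rename Fin.succ (linForm (complexCol A j))) _
      fun j _ => hlin (complexCol A j))
  have h2 : xWeight d 0 + ∑ _j ∈ S, ((0, 1) : ℕ × ℕ) = zWeight n S := by
    simp [xWeight, zWeight]
  rw [h2] at h1
  rw [zonotopeHom, aeval_X, monomial_setExp, map_prod, map_prod]
  simpa [colHom] using h1

theorem zonotopeHom_monomial_isWeightedHomogeneous (s : Finset (Fin n) →₀ ℕ) (r : ℂ) :
    IsWeightedHomogeneous (xWeight d) (zonotopeHom A (monomial s r))
      (Finsupp.weight (zWeight n) s) := by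
  rw [monomial_eq, map_mul, ← algebraMap_eq, AlgHom.commutes, algebraMap_eq, Finsupp.prod, map_prod]
  have := (isWeightedHomogeneous_C (xWeight d) r).mul
    (IsWeightedHomogeneous.prod s.support (fun S => zonotopeHom A (X S) ^ s S) _
      fun S _ => (zonotopeHom_X_isWeightedHomogeneous S).pow (s S))
  rw [zero_add] at this
  simpa [Finsupp.weight_apply, Finsupp.sum] using this

theorem weightedHomogeneousComponent_zonotopeHom (b : ℕ × ℕ)
    (F : MvPolynomial (Finset (Fin n)) ℂ) :
    weightedHomogeneousComponent (xWeight d) b (zonotopeHom A F) =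
      zonotopeHom A (weightedHomogeneousComponent (zWeight n) b F) := by
  induction F using MvPolynomial.induction_on' with
  | monomial s r =>
    have h1 := zonotopeHom_monomial_isWeightedHomogeneous (A := A) s r
    have h2 := isWeightedHomogeneous_monomial (zWeight n) s r rfl
    by_cases h : Finsupp.weight (zWeight n) s = b
    · rw [h] at h1 h2
      rw [weightedHomogeneousComponent_of_mem h1, weightedHomogeneousComponent_of_mem h2]
      simp
    · rw [weightedHomogeneousComponent_of_mem h1, weightedHomogeneousComponent_of_mem h2,
        if_neg (Ne.symm h), if_neg (Ne.symm h), map_zero]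
  | add F G hF hG => rw [map_add, map_add, hF, hG, map_add, map_add]

/-- The homomorphism commutes with taking bihomogeneous components, so a bihomogeneous element of
the image has a preimage of the same bidegree. -/
theorem map_zonotopeHom_zPiece (hA : IsUnimodularMatrix A) (b : ℕ × ℕ) :
    (zPiece n b).map (zonotopeHom A).toLinearMap = harmonicPiece (zonotope A) b := by
  refine le_antisymm ?_ ?_
  · rintro _ ⟨F, hF, rfl⟩
    refine ⟨?_, ?_⟩
    · rw [← range_zonotopeHom hA]
      exact ⟨F, rfl⟩
    · have := weightedHomogeneousComponent_zonotopeHom (A := A) b F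
      rw [IsWeightedHomogeneous.weightedHomogeneousComponent_same hF] at this
      change zonotopeHom A F ∈ _
      rw [← this]
      exact weightedHomogeneousComponent_mem _ _ _
  · rintro h ⟨hH, hb⟩
    rw [← range_zonotopeHom hA] at hH
    obtain ⟨F, rfl⟩ := hH
    refine ⟨weightedHomogeneousComponent (zWeight n) b F, weightedHomogeneousComponent_mem _ _ _, ?_⟩
    change zonotopeHom A _ = zonotopeHom A F
    rw [← weightedHomogeneousComponent_zonotopeHom]
    exact IsWeightedHomogeneous.weightedHomogeneousComponent_same hb

end HarmonicAlgebra

theorem mainTheorem5 (n : ℕ) :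
    (∀ (L : Submodule ℂ (Fin n → ℂ)) (α : Finset (Fin n) → Fin n → ℂ), IsCircuitChoice L α →
      IsBihomogeneous (segreIdeal L α) ∧
      (1 ≤ n → RingHom.ker (phi L α) = segreIdeal L α) ∧
      segreVanishingIdeal L = segreIdeal L α) ∧
    (∀ (d : ℕ) (A : Matrix (Fin d) (Fin n) ℤ), IsUnimodularMatrix A →
      ∃ H : Subalgebra ℂ (MvPolynomial (Fin (d + 1)) ℂ),
        Subalgebra.toSubmodule H = harmonicAlgebra (zonotope A) ∧
        ∀ α : Finset (Fin n) → Fin n → ℂ, IsCircuitChoice (rowSpace A) α →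
          ∃ e : (MvPolynomial (Finset (Fin n)) ℂ ⧸ segreIdeal (rowSpace A) α) ≃ₐ[ℂ] H,
            ∀ b : ℕ × ℕ,
              ((zPiece n b).map (Ideal.Quotient.mkₐ ℂ (segreIdeal (rowSpace A) α)).toLinearMap).map
                (H.val.toLinearMap ∘ₗ e.toLinearMap) = harmonicPiece (zonotope A) b) := by
  refine ⟨fun L α hα => ⟨segreIdeal_isBihomogeneous, ker_phi_eq hα, segreVanishingIdeal_eq hα⟩,
    fun d A hA => ⟨(zonotopeHom A).range, range_zonotopeHom hA, fun α hα => ?_⟩⟩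
  have hker : segreIdeal (rowSpace A) α = RingHom.ker (zonotopeHom A).rangeRestrict := by
    rw [← ker_zonotopeHom hα, AlgHom.ker_rangeRestrict]
  refine ⟨(Ideal.quotientEquivAlgOfEq ℂ hker).trans
    (Ideal.quotientKerAlgEquivOfSurjective (zonotopeHom A).rangeRestrict_surjective), fun b => ?_⟩
  rw [← map_zonotopeHom_zPiece hA, ← Submodule.map_comp]
  rfl
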